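/- Let $W$ be a positive random variable with $E[W^4]<\infty$. For $n\in\mathbb N$ consider the generalised random graph on the vertices $\{1,\dots,n\}$: given i.i.d. copies $W_1,\dots,W_n$ of $W$ and $L_n=\sum_{i=1}^n W_i$, any two distinct vertices $i,j$ are connected, conditionally independently over the unordered pairs, with probability $W_iW_j/(W_iW_j+L_n)$. For a finite set $A\subseteq\{3,4,\dots\}$ let $\mathcal C_n(A)$ be the number of cycles of this graph whose length lies in $A$, and for $k\ge 3$ let $$\lambda_k=\frac1{2k}\left(\frac{E[W^2]}{E[W]}\right)^k .$$ For $\mathbb N_0$-valued random variables $X,Y$ write $d_{TV}(X,Y)=\sup_{B\subseteq\mathbb N_0}|P(X\in B)-P(Y\in B)|$. Then for every $N\in\mathbb N$ there is a constant $C>0$ (depending only on $N$ and the distribution of $W$) such that, for all $A\subseteq\{3,4,\dots,N\}$ and all $n\ge 3$, $$d_{TV}\big(\mathcal C_n(A),\,Z_A\big)\le\frac Cn,\qquad Z_A\sim\mathrm{Poisson}\Big(\sum_{k\in A}\lambda_k\Big),$$ where $\mathrm{Poisson}(0)$ is the point mass at $0$. -/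

import Mathlib

open MeasureTheory ProbabilityTheory
open scoped NNReal ENNReal

namespace GenRandGraph

/-- The connection probability `w i * w j / (w i * w j + L)` of two distinct vertices `i`, `j`,
where `L` is the sum of all the weights. -/
noncomputable def edgeProb {n : ℕ} (w : Fin n → ℝ) (i j : Fin n) : ℝ :=
  w i * w j / (w i * w j + ∑ l, w l)

open Classical in
/-- The probability that the graph equals `H` when, given the weights `w`, any two distinct
vertices `i`, `j` are connected with probability `edgeProb w i j`, independently over the
unordered pairs of vertices. Each unordered pair is represented by the `(i, j)` with `i < j`. -/
noncomputable def graphProb {n : ℕ} (w : Fin n → ℝ) (H : SimpleGraph (Fin n)) : ℝ :=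
  ∏ e : Fin n × Fin n with e.1 < e.2,
    if H.Adj e.1 e.2 then edgeProb w e.1 e.2 else 1 - edgeProb w e.1 e.2

theorem measurable_graphProb {n : ℕ} (H : SimpleGraph (Fin n)) :
    Measurable fun w : Fin n → ℝ => graphProb w H := by
  classical
  unfold graphProb edgeProb
  refine Finset.measurable_fun_prod _ fun e _ => ?_
  split_ifs <;> fun_prop

/-- The conditional law of the graph on the vertices `Fin n` given the weights. -/
noncomputable def graphKernel (n : ℕ) : Kernel (Fin n → ℝ) (SimpleGraph (Fin n)) where
  toFun w := Measure.sum fun H : SimpleGraph (Fin n) =>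
    ENNReal.ofReal (graphProb w H) • Measure.dirac H
  measurable' := by
    refine Measure.measurable_of_measurable_coe _ fun s hs => ?_
    simp only [Measure.sum_apply _ hs, Measure.smul_apply, smul_eq_mul]
    exact Measurable.tsum fun H =>
      (measurable_graphProb H).ennreal_ofReal.mul measurable_const

/-- The law of the generalised random graph on `n` vertices whose weights are i.i.d. with
distribution `ν`. -/
noncomputable def graphLaw (ν : Measure ℝ) (n : ℕ) : Measure (SimpleGraph (Fin n)) :=
  (Measure.pi fun _ : Fin n => ν).bind (graphKernel n)

/-- For `3 ≤ k`, the tuples of pairwise distinct vertices that start at their smallest entry and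
whose second entry is smaller than the last one. Fixing in this way the starting vertex and the
orientation, each possible cycle of length `k` corresponds to exactly one such tuple. -/
def IsCycleIndex {n k : ℕ} (α : Fin k → Fin n) : Prop :=
  Function.Injective α ∧
  (∀ i j : Fin k, i.val = 0 → α i ≤ α j) ∧
  (∀ i j : Fin k, i.val = 1 → j.val + 1 = k → α i < α j)

/-- The cycle `α 0, α 1, …, α (k - 1), α 0` exists in `G`; here `finRotate k` is the cyclic
shift `i ↦ i + 1` modulo `k`. -/
def CycleExists {n k : ℕ} (G : SimpleGraph (Fin n)) (α : Fin k → Fin n) : Prop :=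
  ∀ i : Fin k, G.Adj (α i) (α (finRotate k i))

open Classical in
/-- The number of cycles of `G` whose length lies in `A`, for a finite set `A` of integers that
are at least `3`. -/
noncomputable def cycleCount {n : ℕ} (A : Finset ℕ) (G : SimpleGraph (Fin n)) : ℕ :=
  ∑ k ∈ A, (Finset.univ.filter fun α : Fin k → Fin n => IsCycleIndex α ∧ CycleExists G α).card

theorem measurable_cycleCount {n : ℕ} (A : Finset ℕ) :
    Measurable (cycleCount A : SimpleGraph (Fin n) → ℕ) := by
  classical
  unfold cycleCount
  refine Finset.measurable_fun_sum _ fun k _ => ?_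
  simp only [Finset.card_filter]
  refine Finset.measurable_fun_sum _ fun α _ => ?_
  refine Measurable.ite ?_ measurable_const measurable_const
  refine measurableSet_setOfPred.2 (measurable_const.and ?_)
  unfold CycleExists
  refine Measurable.forall fun i => ?_
  exact SimpleGraph.measurable_iff_adj.1 measurable_id _ _

/-- `(1 / (2 k)) (E[W²] / E[W]) ^ k`. -/
noncomputable def cycleRate {Ω : Type*} [MeasurableSpace Ω] (μ : Measure Ω) (W : Ω → ℝ) (k : ℕ) :
    ℝ :=
  1 / (2 * k) * ((∫ ω, W ω ^ 2 ∂μ) / ∫ ω, W ω ∂μ) ^ k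

/-- Total variation distance of two probability measures on `ℕ`: the supremum of
`|P B - Q B|` over all sets `B` of natural numbers. -/
noncomputable def tvDist (P Q : Measure ℕ) : ℝ :=
  ⨆ B : Set ℕ, |P.real B - Q.real B|

end GenRandGraph

/-!
Given the weights `w`, the cycle count is a sum of indicators, one for each possible cycle, and two
of them depend on each other only if the cycles have a common edge. The Stein–Chen method
(`abs_graphMean_copyCount_sub_poissonMean_le`) therefore compares the conditional law with the
Poisson law of mean `condRate A w`, the conditional mean of the count. The error is a sum over
pairs of cycles with a common edge. The union of two distinct cycles of this kind has more edges
than vertices (`card_cycleVerts_union_lt`), and every edge costs a factor `O(1 / n)` while every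
vertex offers only `n` choices, so the error is `O(1 / n)` in expectation
(`integral_overlapSum_le`). No vertex has degree above `4` in such a union, so fourth moments
suffice.

The conditional mean fluctuates at order `1 / √n` around `λ = ∑ k ∈ A, λ_k`, which would only give
that rate if the two Poisson laws were compared for each `w`. However, the Poisson probability `h t`
of a fixed set is a smooth function of the mean `t`, and so
`h (condRate A w) = h λ + h' λ * (condRate A w - λ) + O((condRate A w - λ) ^ 2)`
(`abs_poissonMean_taylor_le`). Up to `O(1 / n)` in expectation, `condRate A w` is
`∑ k ∈ A, u k * l⁻¹ ^ k / (2 * k)`, with `l` the mean weight and `u k` the normalized sum over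
injective tuples of `k` vertices of the products of the squared weights
(`sub_condRate_mem_Icc`; the `2 * k` comes from the dihedral symmetry of a cycle,
`sum_injective_eq_two_mul_sum_isCycleIndex`). Both `l` and `u k` have mean squared deviation
`O(1 / n)` from `E[W]` and `E[W²] ^ k` (`exists_integral_injMean_sub_sq_le`), and expectations that
differ from these by `O(1 / n)`; so the linear part of the expansion and the remainder both have
expectations `O(1 / n)`.

Neither the Stein–Chen bound, whose constant grows with the conditional mean, nor the expansion in
`l⁻¹` is uniform in `w`. They are used only where `l` and the `u k` are close to their limits;
elsewhere the squared deviation is bounded below, and so it absorbs the trivial bound `1`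
(`exists_abs_graphMean_taylor_le`).
-/

namespace GenRandGraph

/-! ### Poisson expectations and the Stein equation -/

/-- The expectation of `b Z` for a Poisson variable `Z` of mean `t`, written as a power series so
that it makes sense, and can be differentiated, at every real `t`. -/
noncomputable def poissonMean (b : ℕ → ℝ) (t : ℝ) : ℝ :=
  Real.exp (-t) * ∑' k, b k * (t ^ k / (k.factorial : ℝ))

theorem summable_mul_pow_div_factorial {b : ℕ → ℝ} {M : ℝ} (hb : ∀ k, |b k| ≤ M) (t : ℝ) :
    Summable fun k => b k * (t ^ k / (k.factorial : ℝ)) := by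
  refine Summable.of_norm_bounded
    ((Real.summable_pow_div_factorial |t|).mul_left M) fun k => ?_
  rw [norm_mul, norm_div, norm_pow, Real.norm_eq_abs, Real.norm_eq_abs, Real.norm_eq_abs,
    Nat.abs_cast]
  exact mul_le_mul_of_nonneg_right (hb k) (by positivity)

theorem abs_poissonMean_le {b : ℕ → ℝ} {M : ℝ} (hb : ∀ k, |b k| ≤ M) {t : ℝ} (ht : 0 ≤ t) :
    |poissonMean b t| ≤ M := by
  have hM : 0 ≤ M := (abs_nonneg _).trans (hb 0)
  have hs := (NormedSpace.expSeries_div_hasSum_exp t).mul_left M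
  rw [← Real.exp_eq_exp_ℝ] at hs
  have h : ‖∑' k, b k * (t ^ k / (k.factorial : ℝ))‖ ≤ M * Real.exp t := by
    refine tsum_of_norm_bounded hs fun k => ?_
    rw [norm_mul, Real.norm_eq_abs, Real.norm_of_nonneg (by positivity)]
    exact mul_le_mul_of_nonneg_right (hb k) (by positivity)
  rw [poissonMean, abs_mul, abs_of_pos (Real.exp_pos _)]
  calc Real.exp (-t) * |∑' k, b k * (t ^ k / (k.factorial : ℝ))|
      ≤ Real.exp (-t) * (M * Real.exp t) := by gcongr; exact h
    _ = M * (Real.exp (-t) * Real.exp t) := by ring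
    _ = M := by rw [← Real.exp_add]; simp

theorem hasDerivAt_tsum_pow_div_factorial {b : ℕ → ℝ} {M : ℝ} (hb : ∀ k, |b k| ≤ M) (t : ℝ) :
    HasDerivAt (fun t => ∑' k, b k * (t ^ k / (k.factorial : ℝ)))
      (∑' k, b (k + 1) * (t ^ k / (k.factorial : ℝ))) t := by
  set R : ℝ := |t| + 1
  have hR : 0 < R := by positivity
  have key := hasDerivAt_tsum_of_isPreconnected (𝕜 := ℝ) (F := ℝ)
    (g := fun (k : ℕ) (t : ℝ) => b k * (t ^ k / (k.factorial : ℝ)))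
    (g' := fun (k : ℕ) (t : ℝ) => b k * ((k : ℝ) * t ^ (k - 1) / (k.factorial : ℝ)))
    (u := fun k : ℕ => M * ((k : ℝ) * R ^ (k - 1) / (k.factorial : ℝ)))
    (t := Metric.ball 0 R) (y₀ := t) (y := t) ?_ Metric.isOpen_ball
    (convex_ball _ _).isPreconnected ?_ ?_ (by simp [R])
    (summable_mul_pow_div_factorial hb t) (by simp [R])
  · convert! key using 1
    have hs : Summable fun k => b k * ((k : ℝ) * t ^ (k - 1) / (k.factorial : ℝ)) := by
      rw [← summable_nat_add_iff 1]
      convert! summable_mul_pow_div_factorial (b := fun k => b (k + 1)) (fun k => hb _) t using 2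
        with k
      rw [Nat.factorial_succ]
      push_cast
      field_simp
    rw [hs.tsum_eq_zero_add]
    simp only [CharP.cast_eq_zero, zero_mul, zero_div, mul_zero, zero_add]
    refine tsum_congr fun k => ?_
    rw [Nat.factorial_succ]
    push_cast
    field_simp
  · rw [← summable_nat_add_iff 1]
    convert! (Real.summable_pow_div_factorial R).mul_left M using 2 with k
    rw [Nat.factorial_succ]
    push_cast
    field_simp
  · intro k y _
    exact ((hasDerivAt_pow k y).div_const _).const_mul _
  · intro k y hy
    have hy' : |y| ≤ R := by
      rw [mem_ball_zero_iff, Real.norm_eq_abs] at hy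
      exact hy.le
    rw [norm_mul, Real.norm_eq_abs, norm_div, norm_mul, norm_pow, Real.norm_natCast,
      Real.norm_natCast, Real.norm_eq_abs]
    have hM : 0 ≤ M := (abs_nonneg _).trans (hb 0)
    gcongr
    exact hb k

/-- Differentiating a Poisson expectation in its mean takes the forward difference of the
integrand. -/
theorem hasDerivAt_poissonMean {b : ℕ → ℝ} {M : ℝ} (hb : ∀ k, |b k| ≤ M) (t : ℝ) :
    HasDerivAt (poissonMean b) (poissonMean (fun k => b (k + 1) - b k) t) t := by
  have h := ((hasDerivAt_neg t).exp).mul (hasDerivAt_tsum_pow_div_factorial hb t)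
  convert! h using 1
  simp only [poissonMean, sub_mul]
  rw [(summable_mul_pow_div_factorial (fun k => hb (k + 1)) t).tsum_sub
    (summable_mul_pow_div_factorial hb t)]
  ring

theorem abs_poissonMean_sub_le {b : ℕ → ℝ} {M : ℝ} (hb : ∀ k, |b k| ≤ M) {x y : ℝ}
    (hx : 0 ≤ x) (hy : 0 ≤ y) :
    |poissonMean b y - poissonMean b x| ≤ 2 * M * |y - x| := by
  have hb' : ∀ k, |b (k + 1) - b k| ≤ 2 * M := fun k =>
    (abs_sub _ _).trans (by linarith [hb k, hb (k + 1)])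
  exact (convex_Ici (0 : ℝ)).norm_image_sub_le_of_norm_hasDerivWithin_le
    (fun t _ => (hasDerivAt_poissonMean hb t).hasDerivWithinAt)
    (fun t ht => abs_poissonMean_le hb' ht) hx hy

/-- Second-order Taylor bound for a Poisson expectation as a function of its mean. -/
theorem abs_poissonMean_taylor_le {b : ℕ → ℝ} {M : ℝ} (hb : ∀ k, |b k| ≤ M) {x y : ℝ}
    (hx : 0 ≤ x) (hy : 0 ≤ y) :
    |poissonMean b y - poissonMean b x - poissonMean (fun k => b (k + 1) - b k) x * (y - x)|
      ≤ 4 * M * (y - x) ^ 2 := by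
  set d := poissonMean (fun k => b (k + 1) - b k) with hd
  have hb' : ∀ k, |b (k + 1) - b k| ≤ 2 * M := fun k =>
    (abs_sub _ _).trans (by linarith [hb k, hb (k + 1)])
  have hsub : Set.uIcc x y ⊆ Set.Ici 0 := (convex_Ici (0 : ℝ)).ordConnected.uIcc_subset hx hy
  have hM : 0 ≤ M := (abs_nonneg _).trans (hb 0)
  have h := (convex_uIcc x y).norm_image_sub_le_of_norm_hasDerivWithin_le
    (f := fun t => poissonMean b t - d x * t) (f' := fun t => d t - d x) (C := 4 * M * |y - x|)
    (x := x) (y := y)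
    (fun t _ => by
      have := ((hasDerivAt_poissonMean hb t).sub ((hasDerivAt_id t).const_mul (d x)))
      rw [mul_one] at this
      exact this.hasDerivWithinAt)
    (fun t ht => by
      have h1 := abs_poissonMean_sub_le hb' hx (hsub ht)
      have h2 : |t - x| ≤ |y - x| := Set.abs_sub_left_of_mem_uIcc ht
      rw [Real.norm_eq_abs]
      nlinarith)
    Set.left_mem_uIcc Set.right_mem_uIcc
  rw [Real.norm_eq_abs, Real.norm_eq_abs] at h
  calc _ = |(poissonMean b y - d x * y) - (poissonMean b x - d x * x)| := by congr 1; ring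
    _ ≤ _ := h
    _ = 4 * M * |y - x| ^ 2 := by ring
    _ = _ := by rw [sq_abs]

theorem abs_indicator_one_le (B : Set ℕ) (k : ℕ) : |B.indicator (1 : ℕ → ℝ) k| ≤ 1 := by
  by_cases h : k ∈ B <;> simp [h]

theorem poissonMean_indicator_mem_Icc (B : Set ℕ) {t : ℝ} (ht : 0 ≤ t) :
    poissonMean (B.indicator 1) t ∈ Set.Icc (0 : ℝ) 1 := by
  refine ⟨?_, (le_abs_self _).trans (abs_poissonMean_le (abs_indicator_one_le B) ht)⟩
  refine mul_nonneg (Real.exp_pos _).le (tsum_nonneg fun k => mul_nonneg ?_ (by positivity))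
  exact Set.indicator_nonneg (by simp) _

theorem poissonMeasure_real_eq_poissonMean (r : ℝ≥0) (B : Set ℕ) :
    (poissonMeasure r).real B = poissonMean (B.indicator 1) r := by
  have hB : MeasurableSet B := MeasurableSet.of_discrete
  rw [← integral_indicator_one hB, integral_poissonMeasure, poissonMean, ← tsum_mul_left]
  refine tsum_congr fun k => ?_
  rw [smul_eq_mul]
  ring

theorem factorial_div_factorial_le (k i : ℕ) :
    (k.factorial : ℝ) / ((k + 1 + i).factorial : ℝ) ≤ 1 / (i.factorial : ℝ) := by
  rw [div_le_div_iff₀ (by positivity) (by positivity), one_mul]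
  have h1 := Nat.factorial_mul_factorial_dvd_factorial_add k i
  have h2 : (k + i).factorial ≤ (k + 1 + i).factorial := Nat.factorial_le (by omega)
  exact_mod_cast (Nat.le_of_dvd (by positivity) h1).trans h2

/-- The Stein equation of the Poisson distribution has a bounded solution. The bound `exp t` is
far from optimal, but it is enough as long as `t` stays bounded. -/
theorem exists_stein_solution (B : Set ℕ) {t : ℝ} (ht : 0 ≤ t) :
    ∃ f : ℕ → ℝ, (∀ k, |f k| ≤ Real.exp t) ∧
      ∀ k : ℕ, t * f (k + 1) - k * f k = B.indicator 1 k - poissonMean (B.indicator 1) t := by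
  obtain ⟨hp0, hp1⟩ := poissonMean_indicator_mem_Icc B ht
  set p := poissonMean (B.indicator 1) t with hp
  set h : ℕ → ℝ := fun k => B.indicator 1 k - p with hh
  have hh1 : ∀ k, |h k| ≤ 1 := fun k => by
    by_cases hk : k ∈ B <;> simp [hh, hk, abs_le] <;> constructor <;> linarith
  -- The solution that stays bounded at infinity is the tail sum of the series.
  set a : ℕ → ℕ → ℝ := fun k i =>
    t ^ i * ((k.factorial : ℝ) / ((k + 1 + i).factorial : ℝ)) * h (k + 1 + i) with ha
  have hbound : ∀ k i, ‖a k i‖ ≤ t ^ i / (i.factorial : ℝ) := fun k i => by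
    rw [Real.norm_eq_abs, abs_mul, abs_of_nonneg (by positivity)]
    calc _ ≤ t ^ i * (1 / (i.factorial : ℝ)) * 1 :=
          mul_le_mul (mul_le_mul_of_nonneg_left (factorial_div_factorial_le k i) (by positivity))
            (hh1 _) (abs_nonneg _) (by positivity)
      _ = _ := by ring
  have hexp := NormedSpace.expSeries_div_hasSum_exp t
  rw [← Real.exp_eq_exp_ℝ] at hexp
  have hsum : ∀ k, Summable (a k) := fun k =>
    Summable.of_norm_bounded hexp.summable (hbound k)
  refine ⟨fun k => Nat.casesOn k 0 fun k => -∑' i, a k i, ?_, ?_⟩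
  · rintro (_ | k)
    · simpa using (Real.exp_pos t).le
    · rw [abs_neg]
      exact tsum_of_norm_bounded hexp (hbound k)
  · rintro (_ | k)
    · have hs1 := summable_mul_pow_div_factorial hh1 t
      have h0 : ∑' k, h k * (t ^ k / (k.factorial : ℝ)) = 0 := by
        simp only [hh, sub_mul]
        rw [(summable_mul_pow_div_factorial (abs_indicator_one_le B) t).tsum_sub
          (hexp.summable.mul_left p), tsum_mul_left, hexp.tsum_eq]
        have : ∑' k, B.indicator 1 k * (t ^ k / (k.factorial : ℝ)) = p * Real.exp t := by
          rw [hp, poissonMean, mul_right_comm, ← Real.exp_add]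
          simp
        rw [this, sub_self]
      rw [hs1.tsum_eq_zero_add] at h0
      have h1 : t * ∑' i, a 0 i = ∑' k, h (k + 1) * (t ^ (k + 1) / ((k + 1).factorial : ℝ)) := by
        rw [← tsum_mul_left]
        refine tsum_congr fun k => ?_
        simp only [ha, Nat.factorial_zero, Nat.cast_one, zero_add, add_comm 1 k]
        ring
      simp only [CharP.cast_eq_zero, zero_mul, sub_zero, mul_neg, h1]
      simp only [pow_zero, Nat.factorial_zero, Nat.cast_one, div_one, mul_one] at h0
      linarith
    · have h1 : (k + 1 : ℝ) * ∑' i, a k i = h (k + 1) + t * ∑' i, a (k + 1) i := by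
        rw [(hsum k).tsum_eq_zero_add, mul_add, ← tsum_mul_left, ← tsum_mul_left]
        congr 1
        · simp only [ha, pow_zero, add_zero, one_mul]
          rw [Nat.factorial_succ]
          push_cast
          field_simp
        · refine tsum_congr fun i => ?_
          simp only [ha]
          rw [show k + 1 + (i + 1) = k + 1 + 1 + i by ring, Nat.factorial_succ k]
          push_cast
          ring
      push_cast
      linarith

/-! ### Conditional expectations given the weights -/

variable {n : ℕ}

/-- The conditional expectation of `F` of the random graph, given the weights `w`. -/
noncomputable def graphMean (w : Fin n → ℝ) (F : SimpleGraph (Fin n) → ℝ) : ℝ :=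
  ∑ H, graphProb w H * F H

theorem edgeProb_comm (w : Fin n → ℝ) (i j : Fin n) : edgeProb w i j = edgeProb w j i := by
  simp only [edgeProb, mul_comm]

/-- `edgeProb` as a function of the unordered pair. -/
noncomputable def pairProb (w : Fin n → ℝ) : Sym2 (Fin n) → ℝ :=
  Sym2.lift ⟨edgeProb w, edgeProb_comm w⟩

theorem edgeProb_mem_Icc {w : Fin n → ℝ} (hw : ∀ i, 0 < w i) (i j : Fin n) :
    edgeProb w i j ∈ Set.Icc (0 : ℝ) 1 := by
  have h1 : 0 < w i * w j := mul_pos (hw i) (hw j)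
  have h2 : 0 ≤ ∑ l, w l := Finset.sum_nonneg fun l _ => (hw l).le
  refine ⟨div_nonneg h1.le (by linarith), div_le_one_of_le₀ (by linarith) (by linarith)⟩

theorem pairProb_mem_Icc {w : Fin n → ℝ} (hw : ∀ i, 0 < w i) (e : Sym2 (Fin n)) :
    pairProb w e ∈ Set.Icc (0 : ℝ) 1 := by
  induction e with
  | _ i j => exact edgeProb_mem_Icc hw i j

theorem graphProb_nonneg {w : Fin n → ℝ} (hw : ∀ i, 0 < w i) (H : SimpleGraph (Fin n)) :
    0 ≤ graphProb w H := by
  classical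
  refine Finset.prod_nonneg fun e _ => ?_
  have := edgeProb_mem_Icc hw e.1 e.2
  split_ifs
  · exact this.1
  · linarith [this.2]

theorem sum_graphProb (w : Fin n → ℝ) : ∑ H, graphProb w H = 1 := by
  classical
  set E : Finset (Fin n × Fin n) := Finset.univ.filter fun e => e.1 < e.2 with hE
  have h1 : ∏ e ∈ E, (edgeProb w e.1 e.2 + (1 - edgeProb w e.1 e.2)) = 1 :=
    Finset.prod_eq_one fun e _ => by ring
  rw [← h1, Finset.prod_add]
  refine Finset.sum_bij' (fun H _ => E.filter fun e => H.Adj e.1 e.2)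
    (fun T _ => SimpleGraph.fromRel fun i j => (i, j) ∈ T) ?_ ?_ ?_ ?_ ?_
  · intro H _
    simp
  · simp
  · intro H _
    ext i j
    simp only [SimpleGraph.fromRel_adj, Finset.mem_filter, hE, Finset.mem_univ, true_and]
    constructor
    · rintro ⟨-, h | h⟩
      · exact h.2
      · exact h.2.symm
    · intro h
      refine ⟨h.ne, ?_⟩
      rcases lt_or_gt_of_ne h.ne with hlt | hlt
      · exact Or.inl ⟨hlt, h⟩
      · exact Or.inr ⟨hlt, h.symm⟩
  · intro T hT
    rw [Finset.mem_powerset] at hT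
    ext ⟨i, j⟩
    simp only [Finset.mem_filter, SimpleGraph.fromRel_adj]
    constructor
    · rintro ⟨hij, -, h | h⟩
      · exact h
      · have h1 := hT h
        simp only [hE, Finset.mem_filter, Finset.mem_univ, true_and] at hij h1
        exact absurd hij h1.not_gt
    · intro h
      have h1 := hT h
      refine ⟨h1, ?_, Or.inl h⟩
      simp only [hE, Finset.mem_filter, Finset.mem_univ, true_and] at h1
      exact h1.ne
  · intro H _
    rw [graphProb, Finset.prod_ite, Finset.filter_not]

theorem graphMean_sub (w : Fin n → ℝ) (F F' : SimpleGraph (Fin n) → ℝ) :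
    graphMean w (fun H => F H - F' H) = graphMean w F - graphMean w F' := by
  simp only [graphMean, mul_sub, Finset.sum_sub_distrib]

theorem graphMean_const_mul (w : Fin n → ℝ) (c : ℝ) (F : SimpleGraph (Fin n) → ℝ) :
    graphMean w (fun H => c * F H) = c * graphMean w F := by
  simp only [graphMean, Finset.mul_sum]
  exact Finset.sum_congr rfl fun H _ => by ring

theorem graphMean_const (w : Fin n → ℝ) (c : ℝ) : graphMean w (fun _ => c) = c := by
  simp only [graphMean, ← Finset.sum_mul, sum_graphProb, one_mul]

theorem graphMean_sum {ι : Type*} (w : Fin n → ℝ) (s : Finset ι)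
    (F : ι → SimpleGraph (Fin n) → ℝ) :
    graphMean w (fun H => ∑ i ∈ s, F i H) = ∑ i ∈ s, graphMean w (F i) := by
  simp only [graphMean, Finset.mul_sum]
  exact Finset.sum_comm

theorem graphMean_mono {w : Fin n → ℝ} (hw : ∀ i, 0 < w i) {F F' : SimpleGraph (Fin n) → ℝ}
    (h : ∀ H, F H ≤ F' H) : graphMean w F ≤ graphMean w F' :=
  Finset.sum_le_sum fun H _ => mul_le_mul_of_nonneg_left (h H) (graphProb_nonneg hw H)

theorem abs_graphMean_le {w : Fin n → ℝ} (hw : ∀ i, 0 < w i) {F F' : SimpleGraph (Fin n) → ℝ}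
    (h : ∀ H, |F H| ≤ F' H) : |graphMean w F| ≤ graphMean w F' := by
  refine (Finset.abs_sum_le_sum_abs _ _).trans (Finset.sum_le_sum fun H _ => ?_)
  rw [abs_mul, abs_of_nonneg (graphProb_nonneg hw H)]
  exact mul_le_mul_of_nonneg_left (h H) (graphProb_nonneg hw H)

/-- The graph `G` with the status of the unordered pair `e` reversed. -/
def flipEdge (e : Sym2 (Fin n)) (G : SimpleGraph (Fin n)) : SimpleGraph (Fin n) :=
  symmDiff G (SimpleGraph.fromEdgeSet {e})

theorem involutive_flipEdge (e : Sym2 (Fin n)) : Function.Involutive (flipEdge e) := fun G => by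
  simp [flipEdge]

theorem mem_edgeSet_flipEdge_of_ne {e e' : Sym2 (Fin n)} (h : e' ≠ e)
    (G : SimpleGraph (Fin n)) : e' ∈ (flipEdge e G).edgeSet ↔ e' ∈ G.edgeSet := by
  simp [flipEdge, symmDiff, SimpleGraph.edgeSet_sup, SimpleGraph.edgeSet_sdiff, h]

theorem mem_edgeSet_flipEdge_self {e : Sym2 (Fin n)} (h : ¬ e.IsDiag)
    (G : SimpleGraph (Fin n)) : e ∈ (flipEdge e G).edgeSet ↔ e ∉ G.edgeSet := by
  simp [flipEdge, symmDiff, SimpleGraph.edgeSet_sup, SimpleGraph.edgeSet_sdiff, h]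

open Classical in
/-- Conditionally on the weights, the presence of the edge `e` is independent of all that does
not depend on the status of `e`. -/
theorem graphMean_edge_mul (w : Fin n → ℝ) {e : Sym2 (Fin n)} (he : ¬ e.IsDiag)
    {F : SimpleGraph (Fin n) → ℝ} (hF : ∀ G, F (flipEdge e G) = F G) :
    graphMean w (fun G => (if e ∈ G.edgeSet then 1 else 0) * F G) =
      pairProb w e * graphMean w F := by
  set p := pairProb w e with hp
  -- Splitting off the factor of `e` leaves a product that `flipEdge e` preserves.
  obtain ⟨R, hR, hGR⟩ : ∃ R : SimpleGraph (Fin n) → ℝ, (∀ G, R (flipEdge e G) = R G) ∧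
      ∀ G, graphProb w G = (if e ∈ G.edgeSet then p else 1 - p) * R G := by
    obtain ⟨i, j, hij, rfl⟩ : ∃ i j : Fin n, i < j ∧ e = s(i, j) := by
      induction e with
      | _ i j =>
        rw [Sym2.mk_isDiag_iff] at he
        rcases lt_or_gt_of_ne he with h | h
        · exact ⟨i, j, h, rfl⟩
        · exact ⟨j, i, h, Sym2.eq_swap⟩
    refine ⟨fun G => ∏ e ∈ (Finset.univ.filter fun e : Fin n × Fin n => e.1 < e.2).erase (i, j),
      if G.Adj e.1 e.2 then edgeProb w e.1 e.2 else 1 - edgeProb w e.1 e.2, ?_, ?_⟩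
    · intro G
      refine Finset.prod_congr rfl fun e he' => ?_
      rw [Finset.mem_erase, Finset.mem_filter] at he'
      have hne : s(e.1, e.2) ≠ s(i, j) := by
        intro h
        rw [Sym2.eq_iff] at h
        rcases h with ⟨h1, h2⟩ | ⟨h1, h2⟩
        · exact he'.1 (Prod.ext h1 h2)
        · have := he'.2.2
          rw [h1, h2] at this
          exact absurd hij this.not_gt
      have := mem_edgeSet_flipEdge_of_ne hne G
      simp only [SimpleGraph.mem_edgeSet] at this
      simp only [this]
    · intro G
      rw [graphProb, ← Finset.mul_prod_erase _ _ (a := (i, j)) (by simp [hij])]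
      rfl
  have hsum : ∑ G, (if e ∉ G.edgeSet then 1 else 0) * (R G * F G) =
      ∑ G, (if e ∈ G.edgeSet then 1 else 0) * (R G * F G) := by
    refine Fintype.sum_equiv (Function.Involutive.toPerm _ (involutive_flipEdge e)) _ _ fun G => ?_
    simp only [Function.Involutive.coe_toPerm, mem_edgeSet_flipEdge_self he, hR, hF]
  have h1 : graphMean w (fun G => (if e ∈ G.edgeSet then 1 else 0) * F G) =
      p * ∑ G, (if e ∈ G.edgeSet then 1 else 0) * (R G * F G) := by
    rw [graphMean, Finset.mul_sum]
    refine Finset.sum_congr rfl fun G _ => ?_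
    rw [hGR]
    split_ifs <;> ring
  have h2 : graphMean w F = p * ∑ G, (if e ∈ G.edgeSet then 1 else 0) * (R G * F G) +
      (1 - p) * ∑ G, (if e ∉ G.edgeSet then 1 else 0) * (R G * F G) := by
    rw [graphMean, Finset.mul_sum, Finset.mul_sum, ← Finset.sum_add_distrib]
    refine Finset.sum_congr rfl fun G _ => ?_
    rw [hGR]
    by_cases hG : e ∈ G.edgeSet <;> simp [hG] <;> ring
  rw [h1, h2, hsum]
  ring

open Classical in
/-- The indicator that all the pairs in `E` are edges of `G`. -/
noncomputable def edgesInd (E : Finset (Sym2 (Fin n))) (G : SimpleGraph (Fin n)) : ℝ :=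
  if (E : Set (Sym2 (Fin n))) ⊆ G.edgeSet then 1 else 0

theorem edgesInd_nonneg (E : Finset (Sym2 (Fin n))) (G : SimpleGraph (Fin n)) :
    0 ≤ edgesInd E G := by
  unfold edgesInd
  split_ifs <;> norm_num

theorem edgesInd_mul_edgesInd [DecidableEq (Sym2 (Fin n))] (E E' : Finset (Sym2 (Fin n)))
    (G : SimpleGraph (Fin n)) : edgesInd E G * edgesInd E' G = edgesInd (E ∪ E') G := by
  unfold edgesInd
  by_cases h : (E : Set (Sym2 (Fin n))) ⊆ G.edgeSet <;>
    by_cases h' : (E' : Set (Sym2 (Fin n))) ⊆ G.edgeSet <;> simp [h, h']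

theorem edgesInd_flipEdge {E : Finset (Sym2 (Fin n))} {e : Sym2 (Fin n)} (he : e ∉ E)
    (G : SimpleGraph (Fin n)) : edgesInd E (flipEdge e G) = edgesInd E G := by
  unfold edgesInd
  congr 1
  refine propext (forall₂_congr fun e' he' => ?_)
  refine mem_edgeSet_flipEdge_of_ne ?_ G
  rintro rfl
  exact he he'

theorem graphMean_edgesInd_mul (w : Fin n → ℝ) {E : Finset (Sym2 (Fin n))}
    (hE : ∀ e ∈ E, ¬ e.IsDiag) {F : SimpleGraph (Fin n) → ℝ}
    (hF : ∀ e ∈ E, ∀ G, F (flipEdge e G) = F G) :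
    graphMean w (fun G => edgesInd E G * F G) = (∏ e ∈ E, pairProb w e) * graphMean w F := by
  classical
  induction E using Finset.induction_on with
  | empty => simp [edgesInd]
  | insert e E he ih =>
    have h1 : ∀ G, edgesInd (insert e E) G * F G =
        (if e ∈ G.edgeSet then 1 else 0) * (edgesInd E G * F G) := fun G => by
      by_cases h : e ∈ G.edgeSet <;> simp [edgesInd, Set.insert_subset_iff, h]
    simp only [h1]
    rw [graphMean_edge_mul w (hE e (by simp)), ih, Finset.prod_insert he, mul_assoc]
    · exact fun e he => hE e (by simp [he])
    · exact fun e he => hF e (by simp [he])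
    · intro G
      rw [edgesInd_flipEdge he, hF e (by simp)]

theorem graphMean_edgesInd (w : Fin n → ℝ) {E : Finset (Sym2 (Fin n))}
    (hE : ∀ e ∈ E, ¬ e.IsDiag) :
    graphMean w (edgesInd E) = ∏ e ∈ E, pairProb w e := by
  have := graphMean_edgesInd_mul w hE (F := fun _ => 1) (fun _ _ _ => rfl)
  simpa [graphMean_const] using this

open Classical in
/-- The number of indices in `I` whose pairs are all edges of `G`. -/
noncomputable def copyCount {ι : Type*} (I : Finset ι) (E : ι → Finset (Sym2 (Fin n)))
    (G : SimpleGraph (Fin n)) : ℕ :=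
  (I.filter fun a => (E a : Set (Sym2 (Fin n))) ⊆ G.edgeSet).card

theorem cast_copyCount {ι : Type*} (I : Finset ι) (E : ι → Finset (Sym2 (Fin n)))
    (G : SimpleGraph (Fin n)) : (copyCount I E G : ℝ) = ∑ a ∈ I, edgesInd (E a) G := by
  classical
  simp [copyCount, edgesInd]

theorem copyCount_flipEdge {ι : Type*} {I : Finset ι} {E : ι → Finset (Sym2 (Fin n))}
    {e : Sym2 (Fin n)} (he : ∀ a ∈ I, e ∉ E a) (G : SimpleGraph (Fin n)) :
    copyCount I E (flipEdge e G) = copyCount I E G := by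
  have h : (copyCount I E (flipEdge e G) : ℝ) = copyCount I E G := by
    simp only [cast_copyCount]
    exact Finset.sum_congr rfl fun a ha => edgesInd_flipEdge (he a ha) G
  exact_mod_cast h

theorem copyCount_filter_add {ι : Type*} (I : Finset ι) (E : ι → Finset (Sym2 (Fin n)))
    (P : ι → Prop) [DecidablePred P] (G : SimpleGraph (Fin n)) :
    copyCount I E G = copyCount (I.filter P) E G + copyCount (I.filter fun a => ¬ P a) E G := by
  have h : (copyCount I E G : ℝ) =
      copyCount (I.filter P) E G + copyCount (I.filter fun a => ¬ P a) E G := by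
    simp only [cast_copyCount]
    exact (Finset.sum_filter_add_sum_filter_not _ _ _).symm
  exact_mod_cast h

theorem abs_sub_le_two_mul_mul_cast {f : ℕ → ℝ} {M : ℝ} (hf : ∀ k, |f k| ≤ M) (k l : ℕ) :
    |f (k + l) - f k| ≤ 2 * M * l := by
  have hM : 0 ≤ M := (abs_nonneg _).trans (hf 0)
  rcases Nat.eq_zero_or_pos l with rfl | hl
  · simp
  · have h1 : (1 : ℝ) ≤ l := by exact_mod_cast hl
    calc |f (k + l) - f k| ≤ |f (k + l)| + |f k| := abs_sub _ _
      _ ≤ 2 * M * 1 := by linarith [hf (k + l), hf k]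
      _ ≤ _ := by gcongr

/-- The contribution of a single index `a` to the Stein–Chen bound. The indices whose pairs meet
those of `a` are dropped from the count, which makes it independent of `a`. -/
theorem abs_stein_term_le {ι : Type*} [DecidableEq ι] [DecidableEq (Sym2 (Fin n))]
    {w : Fin n → ℝ} (hw : ∀ i, 0 < w i) (I : Finset ι) (E : ι → Finset (Sym2 (Fin n)))
    (hE : ∀ a ∈ I, ∀ e ∈ E a, ¬ e.IsDiag) (hne : ∀ a ∈ I, (E a).Nonempty)
    {f : ℕ → ℝ} {M : ℝ} (hf : ∀ k, |f k| ≤ M) {a : ι} (ha : a ∈ I) :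
    |(∏ e ∈ E a, pairProb w e) * graphMean w (fun G => f (copyCount I E G + 1)) -
        graphMean w (fun G => edgesInd (E a) G * f (copyCount I E G))| ≤
      2 * M * ∑ b ∈ I with ¬ Disjoint (E a) (E b),
        ((∏ e ∈ E a, pairProb w e) * (∏ e ∈ E b, pairProb w e) +
          if b = a then 0 else ∏ e ∈ E a ∪ E b, pairProb w e) := by
  set p : Finset (Sym2 (Fin n)) → ℝ := fun F => ∏ e ∈ F, pairProb w e with hp
  have hp0 : 0 ≤ p (E a) := Finset.prod_nonneg fun e _ => (pairProb_mem_Icc hw e).1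
  set D : Finset ι := I.filter fun b => Disjoint (E a) (E b) with hD
  set D' : Finset ι := I.filter fun b => ¬ Disjoint (E a) (E b) with hD'
  have haD' : a ∈ D' := by
    rw [hD', Finset.mem_filter, disjoint_self]
    exact ⟨ha, (hne a ha).ne_empty⟩
  have hS : ∀ G, copyCount I E G = copyCount D E G + copyCount D' E G :=
    copyCount_filter_add I E _
  have hindep : graphMean w (fun G => edgesInd (E a) G * f (copyCount D E G + 1)) =
      p (E a) * graphMean w (fun G => f (copyCount D E G + 1)) := by
    refine graphMean_edgesInd_mul w (hE a ha) fun e he G => ?_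
    rw [copyCount_flipEdge fun b hb heb => ?_]
    exact Finset.disjoint_left.1 (Finset.mem_filter.1 hb).2 he heb
  have h1 : |graphMean w (fun G => f (copyCount I E G + 1) - f (copyCount D E G + 1))| ≤
      2 * M * ∑ b ∈ D', p (E b) := by
    calc _ ≤ graphMean w fun G => 2 * M * ∑ b ∈ D', edgesInd (E b) G := by
          refine abs_graphMean_le hw fun G => ?_
          rw [hS, ← cast_copyCount, add_right_comm]
          exact abs_sub_le_two_mul_mul_cast hf _ _
      _ = _ := by
          rw [graphMean_const_mul, graphMean_sum]
          congr 1
          exact Finset.sum_congr rfl fun b hb =>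
            graphMean_edgesInd w (hE b (Finset.mem_filter.1 hb).1)
  have h2 : |graphMean w (fun G => edgesInd (E a) G *
      (f (copyCount I E G) - f (copyCount D E G + 1)))| ≤
      2 * M * ∑ b ∈ D', if b = a then 0 else p (E a ∪ E b) := by
    calc _ ≤ graphMean w fun G =>
          2 * M * ∑ b ∈ D', if b = a then 0 else edgesInd (E a ∪ E b) G := by
          refine abs_graphMean_le hw fun G => ?_
          have hsum : ∑ b ∈ D', (if b = a then 0 else edgesInd (E a ∪ E b) G) =
              edgesInd (E a) G * ∑ b ∈ D'.erase a, edgesInd (E b) G := by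
            rw [← Finset.sum_erase (a := a) _ (by simp), Finset.mul_sum]
            refine Finset.sum_congr rfl fun b hb => ?_
            rw [if_neg (Finset.ne_of_mem_erase hb), edgesInd_mul_edgesInd]
          rw [hsum, abs_mul, abs_of_nonneg (edgesInd_nonneg _ _), mul_left_comm]
          by_cases hG : (E a : Set (Sym2 (Fin n))) ⊆ G.edgeSet
          · refine mul_le_mul_of_nonneg_left ?_ (edgesInd_nonneg _ _)
            have hcount : copyCount D' E G = 1 + copyCount (D'.erase a) E G := by
              have : (copyCount D' E G : ℝ) = 1 + copyCount (D'.erase a) E G := by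
                rw [cast_copyCount, cast_copyCount, ← Finset.add_sum_erase _ _ haD']
                simp [edgesInd, hG]
              exact_mod_cast this
            rw [hS, hcount, ← cast_copyCount, ← add_assoc]
            exact abs_sub_le_two_mul_mul_cast hf _ _
          · simp [edgesInd, hG]
      _ = _ := by
          rw [graphMean_const_mul, graphMean_sum]
          congr 1
          refine Finset.sum_congr rfl fun b hb => ?_
          split_ifs
          · exact graphMean_const w 0
          · refine graphMean_edgesInd w fun e he => ?_
            rcases Finset.mem_union.1 he with h | h
            · exact hE a ha e h
            · exact hE b (Finset.mem_filter.1 hb).1 e h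
  have h3 : p (E a) * graphMean w (fun G => f (copyCount I E G + 1)) -
        graphMean w (fun G => edgesInd (E a) G * f (copyCount I E G)) =
      p (E a) * graphMean w (fun G => f (copyCount I E G + 1) - f (copyCount D E G + 1)) -
        graphMean w (fun G => edgesInd (E a) G *
          (f (copyCount I E G) - f (copyCount D E G + 1))) := by
    simp only [mul_sub (edgesInd _ _), graphMean_sub, hindep]
    ring
  rw [h3, Finset.sum_add_distrib, ← Finset.mul_sum]
  refine (abs_sub _ _).trans ?_
  rw [abs_mul, abs_of_nonneg hp0]
  calc _ ≤ p (E a) * (2 * M * ∑ b ∈ D', p (E b)) +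
        2 * M * ∑ b ∈ D', (if b = a then 0 else p (E a ∪ E b)) := by gcongr
    _ = _ := by ring

/-- Poisson approximation by the Stein–Chen local approach: given the weights, the number of
copies is Poisson up to an error that only involves pairs of indices with a common edge. -/
theorem abs_graphMean_copyCount_sub_poissonMean_le {ι : Type*} [DecidableEq ι]
    [DecidableEq (Sym2 (Fin n))]
    {w : Fin n → ℝ} (hw : ∀ i, 0 < w i) (I : Finset ι) (E : ι → Finset (Sym2 (Fin n)))
    (hE : ∀ a ∈ I, ∀ e ∈ E a, ¬ e.IsDiag) (hne : ∀ a ∈ I, (E a).Nonempty) (B : Set ℕ) {t : ℝ}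
    (ht : t = ∑ a ∈ I, ∏ e ∈ E a, pairProb w e) :
    |graphMean w (fun G => B.indicator 1 (copyCount I E G)) - poissonMean (B.indicator 1) t| ≤
      2 * Real.exp t * ∑ a ∈ I, ∑ b ∈ I with ¬ Disjoint (E a) (E b),
        ((∏ e ∈ E a, pairProb w e) * (∏ e ∈ E b, pairProb w e) +
          if b = a then 0 else ∏ e ∈ E a ∪ E b, pairProb w e) := by
  have ht0 : 0 ≤ t := ht ▸ Finset.sum_nonneg fun a _ =>
    Finset.prod_nonneg fun e _ => (pairProb_mem_Icc hw e).1
  obtain ⟨f, hf, hstein⟩ := exists_stein_solution B ht0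
  have h1 : graphMean w (fun G => B.indicator 1 (copyCount I E G)) -
      poissonMean (B.indicator 1) t =
      ∑ a ∈ I, ((∏ e ∈ E a, pairProb w e) * graphMean w (fun G => f (copyCount I E G + 1)) -
        graphMean w (fun G => edgesInd (E a) G * f (copyCount I E G))) := by
    rw [Finset.sum_sub_distrib, ← Finset.sum_mul, ← ht, ← graphMean_sum]
    simp only [← Finset.sum_mul, ← cast_copyCount]
    rw [← graphMean_const_mul, ← graphMean_sub]
    simp only [hstein]
    rw [graphMean_sub, graphMean_const]
  rw [h1, Finset.mul_sum]
  exact (Finset.abs_sum_le_sum_abs _ _).trans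
    (Finset.sum_le_sum fun a ha => abs_stein_term_le hw I E hE hne hf ha)

/-! ### Cycles: vertices, edges and dihedral symmetry -/

/-- The vertices of the closed walk `α`. -/
def cycleVerts {k : ℕ} (α : Fin k → Fin n) : Finset (Fin n) :=
  Finset.univ.image α

/-- The edges of the closed walk `α`. -/
def cycleEdges {k : ℕ} (α : Fin k → Fin n) : Finset (Sym2 (Fin n)) :=
  Finset.univ.image fun i => s(α i, α (finRotate k i))

theorem cycleExists_iff {k : ℕ} (G : SimpleGraph (Fin n)) (α : Fin k → Fin n) :
    CycleExists G α ↔ (cycleEdges α : Set (Sym2 (Fin n))) ⊆ G.edgeSet := by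
  simp [CycleExists, cycleEdges, Set.range_subset_iff]

theorem card_cycleVerts {k : ℕ} {α : Fin k → Fin n} (hα : Function.Injective α) :
    (cycleVerts α).card = k := by
  rw [cycleVerts, Finset.card_image_of_injective _ hα, Finset.card_fin]

theorem one_add_one_ne_zero_fin (m : ℕ) : (1 + 1 : Fin (m + 3)) ≠ 0 := by
  simp [Fin.ext_iff, Fin.val_add, Nat.mod_eq_of_lt (show 2 < m + 3 by omega)]

theorem add_one_ne_sub_one_fin {m : ℕ} (j : Fin (m + 3)) : j + 1 ≠ j - 1 := fun h =>
  one_add_one_ne_zero_fin m (by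
    have := congrArg (fun x => x - j + 1) h
    simpa using this)

theorem injective_cycle_edge {k : ℕ} (hk : 3 ≤ k) {α : Fin k → Fin n}
    (hα : Function.Injective α) :
    Function.Injective fun i => s(α i, α (finRotate k i)) := by
  obtain ⟨m, rfl⟩ := Nat.exists_eq_add_of_le' hk
  intro i j h
  simp only [finRotate_apply, Sym2.eq_iff, hα.eq_iff] at h
  rcases h with h | ⟨h1, h2⟩
  · exact h.1
  · rw [h1, add_assoc] at h2
    exact absurd (by simpa using h2) (one_add_one_ne_zero_fin m)

theorem card_cycleEdges {k : ℕ} (hk : 3 ≤ k) {α : Fin k → Fin n} (hα : Function.Injective α) :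
    (cycleEdges α).card = k := by
  rw [cycleEdges, Finset.card_image_of_injective _ (injective_cycle_edge hk hα), Finset.card_fin]

theorem prod_cycleEdges {k : ℕ} (hk : 3 ≤ k) {α : Fin k → Fin n} (hα : Function.Injective α)
    (g : Sym2 (Fin n) → ℝ) :
    ∏ e ∈ cycleEdges α, g e = ∏ i, g s(α i, α (finRotate k i)) := by
  rw [cycleEdges, Finset.prod_image fun i _ j _ h => injective_cycle_edge hk hα h]

theorem not_isDiag_of_mem_cycleEdges {k : ℕ} (hk : 3 ≤ k) {α : Fin k → Fin n}
    (hα : Function.Injective α) {e : Sym2 (Fin n)} (he : e ∈ cycleEdges α) : ¬ e.IsDiag := by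
  obtain ⟨m, rfl⟩ := Nat.exists_eq_add_of_le' hk
  obtain ⟨i, -, rfl⟩ := Finset.mem_image.1 he
  rw [finRotate_apply, Sym2.mk_isDiag_iff, hα.eq_iff]
  simp

theorem nonempty_cycleEdges {k : ℕ} (hk : 3 ≤ k) (α : Fin k → Fin n) :
    (cycleEdges α).Nonempty :=
  ⟨_, Finset.mem_image_of_mem _ (Finset.mem_univ ⟨0, by omega⟩)⟩

/-- The rearrangement of the indices of a cycle of length `k` that moves the start to `j`, and
reverses the orientation if `r` is true. -/
def dihedral {k : ℕ} [NeZero k] (j : Fin k) (r : Bool) : Fin k ≃ Fin k :=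
  if r then Equiv.subLeft j else Equiv.addLeft j

theorem isCycleIndex_iff {m : ℕ} (γ : Fin (m + 3) → Fin n) :
    IsCycleIndex γ ↔ Function.Injective γ ∧ (∀ j, γ 0 ≤ γ j) ∧ γ 1 < γ (-1) := by
  have hlast : (-1 : Fin (m + 3)) = Fin.last (m + 2) :=
    (eq_neg_of_add_eq_zero_left (Fin.last_add_one (m + 2))).symm
  rw [hlast]
  refine and_congr_right fun _ => and_congr ⟨fun h j => h 0 j rfl, fun h i j hi => ?_⟩
    ⟨fun h => h 1 _ (by simp) (by simp), fun h i j hi hj => ?_⟩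
  · obtain rfl : i = 0 := Fin.ext hi
    exact h j
  · obtain rfl : i = 1 := Fin.ext (by simp [hi])
    obtain rfl : j = Fin.last (m + 2) := Fin.ext (by simpa using hj)
    exact h

/-- Each cycle has exactly one parametrization that is a cycle index. -/
theorem existsUnique_dihedral {m : ℕ} {α : Fin (m + 3) → Fin n} (hα : Function.Injective α) :
    ∃! d : Fin (m + 3) × Bool, IsCycleIndex (α ∘ dihedral d.1 d.2) := by
  have key : ∀ j r, IsCycleIndex (α ∘ dihedral j r) ↔
      (∀ i, α j ≤ α i) ∧ if r then α (j - 1) < α (j + 1) else α (j + 1) < α (j - 1) := by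
    intro j r
    have h0 : dihedral j r 0 = j := by cases r <;> simp [dihedral]
    rw [isCycleIndex_iff]
    simp only [Function.comp_apply, h0]
    rw [(dihedral j r).forall_congr_left (p := fun i => α j ≤ α (dihedral j r i))]
    simp only [Equiv.apply_symm_apply]
    rw [and_iff_right (hα.comp (dihedral j r).injective)]
    cases r <;> simp [dihedral, sub_eq_add_neg]
  obtain ⟨j, hj⟩ := Finite.exists_min α
  have huniq : ∀ i, (∀ l, α i ≤ α l) → i = j := fun i hi =>
    hα (le_antisymm (hi j) (hj i))
  rcases lt_or_gt_of_ne (hα.ne (add_one_ne_sub_one_fin j)) with h | h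
  · refine ⟨(j, false), (key _ _).2 ⟨hj, by simpa using h⟩, ?_⟩
    rintro ⟨i, r⟩ hi
    obtain ⟨h1, h2⟩ := (key i r).1 hi
    obtain rfl := huniq i h1
    cases r
    · rfl
    · exact absurd (by simpa using h2) h.not_gt
  · refine ⟨(j, true), (key _ _).2 ⟨hj, by simpa using h⟩, ?_⟩
    rintro ⟨i, r⟩ hi
    obtain ⟨h1, h2⟩ := (key i r).1 hi
    obtain rfl := huniq i h1
    cases r
    · exact absurd (by simpa using h2) h.not_gt
    · rfl

open Classical in
/-- Every cycle of length `k` is counted `2 * k` times by the injective tuples. -/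
theorem sum_injective_eq_two_mul_sum_isCycleIndex {m : ℕ} (g : (Fin (m + 3) → Fin n) → ℝ)
    (hg : ∀ α j r, g (α ∘ dihedral j r) = g α) :
    ∑ α with Function.Injective α, g α =
      2 * ((m + 3 : ℕ) : ℝ) * ∑ α with IsCycleIndex α, g α := by
  have h1 : ∀ α ∈ Finset.univ.filter fun α : Fin (m + 3) → Fin n => Function.Injective α,
      g α = ∑ d : Fin (m + 3) × Bool,
        if IsCycleIndex (α ∘ dihedral d.1 d.2) then g (α ∘ dihedral d.1 d.2) else 0 := by
    intro α hα
    obtain ⟨d, hd, hu⟩ := existsUnique_dihedral (Finset.mem_filter.1 hα).2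
    rw [Finset.sum_eq_single d]
    · rw [if_pos hd, hg]
    · intro d' _ hd'
      rw [if_neg fun h => hd' (hu d' h)]
    · simp
  rw [Finset.sum_congr rfl h1, Finset.sum_comm]
  have h2 : ∀ d : Fin (m + 3) × Bool,
      ∑ α with Function.Injective α,
        (if IsCycleIndex (α ∘ dihedral d.1 d.2) then g (α ∘ dihedral d.1 d.2) else 0) =
      ∑ α with IsCycleIndex α, g α := by
    intro d
    rw [Finset.sum_filter, Finset.sum_filter]
    refine Fintype.sum_equiv (Equiv.arrowCongr (dihedral d.1 d.2).symm (Equiv.refl (Fin n)))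
      _ _ fun α => ?_
    have h3 : Equiv.arrowCongr (dihedral d.1 d.2).symm (Equiv.refl (Fin n)) α =
      α ∘ dihedral d.1 d.2 := rfl
    rw [h3]
    by_cases h : IsCycleIndex (α ∘ dihedral d.1 d.2)
    · have : Function.Injective α := by
        have := h.1.comp (dihedral d.1 d.2).symm.injective
        rwa [Function.comp_assoc, Equiv.self_comp_symm, Function.comp_id] at this
      simp [h, this]
    · simp [h]
  rw [Finset.sum_congr rfl fun d _ => h2 d, Finset.sum_const, Finset.card_univ, nsmul_eq_mul,
    Fintype.card_prod, Fintype.card_fin, Fintype.card_bool]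
  push_cast
  ring

theorem mem_cycleEdges_iff {m : ℕ} {α : Fin (m + 3) → Fin n} (hα : Function.Injective α)
    (x : Fin (m + 3)) (v : Fin n) :
    s(α x, v) ∈ cycleEdges α ↔ v = α (x + 1) ∨ v = α (x - 1) := by
  simp only [cycleEdges, Finset.mem_image, Finset.mem_univ, true_and, finRotate_apply,
    Sym2.eq_iff, hα.eq_iff]
  constructor
  · rintro ⟨i, ⟨rfl, rfl⟩ | ⟨rfl, rfl⟩⟩
    · exact Or.inl rfl
    · exact Or.inr (by simp)
  · rintro (rfl | rfl)
    · exact ⟨x, Or.inl ⟨rfl, rfl⟩⟩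
    · exact ⟨x - 1, Or.inr ⟨rfl, by simp⟩⟩

/-- A cycle all of whose edges are edges of the cycle `α` runs through `α` in one of the two
directions. -/
theorem exists_forall_eq_add_nsmul {m m' : ℕ} {α : Fin (m + 3) → Fin n}
    (hα : Function.Injective α) {β : Fin (m' + 3) → Fin n} (hβ : Function.Injective β)
    (h : cycleEdges β ⊆ cycleEdges α) :
    ∃ j δ : Fin (m + 3), (δ = 1 ∨ δ = -1) ∧ ∀ i : ℕ, β (i • 1) = α (j + i • δ) := by
  have hedge : ∀ i, s(β i, β (i + 1)) ∈ cycleEdges α := fun i => h (by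
    rw [mem_cycleEdges_iff hβ]
    exact Or.inl rfl)
  obtain ⟨j, hj⟩ : ∃ j, β 0 = α j := by
    obtain ⟨i, -, hi⟩ := Finset.mem_image.1 (hedge 0)
    rw [Sym2.eq_iff] at hi
    rcases hi with hi | hi
    · exact ⟨_, hi.1.symm⟩
    · exact ⟨_, hi.2.symm⟩
  obtain ⟨δ, hδ, h1⟩ : ∃ δ : Fin (m + 3), (δ = 1 ∨ δ = -1) ∧ β 1 = α (j + δ) := by
    have h0 := hedge 0
    rw [hj, mem_cycleEdges_iff hα, zero_add] at h0
    rcases h0 with h0 | h0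
    · exact ⟨1, Or.inl rfl, h0⟩
    · exact ⟨-1, Or.inr rfl, by rw [h0, sub_eq_add_neg]⟩
  refine ⟨j, δ, hδ, fun i => ?_⟩
  suffices H : β (i • 1) = α (j + i • δ) ∧ β ((i + 1) • 1) = α (j + (i + 1) • δ) from H.1
  induction i with
  | zero => simpa using ⟨hj, h1⟩
  | succ i ih =>
    refine ⟨ih.2, ?_⟩
    have h2 := hedge ((i + 1) • 1)
    rw [ih.2, mem_cycleEdges_iff hα, ← succ_nsmul] at h2
    have h3 : β ((i + 1 + 1) • 1) ≠ β (i • 1) := fun he => by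
      have := hβ he
      rw [succ_nsmul, succ_nsmul, add_assoc] at this
      exact one_add_one_ne_zero_fin m' (by simpa using this)
    rw [ih.1] at h3
    rw [succ_nsmul δ (i + 1)]
    rcases hδ with rfl | rfl
    · refine (h2.resolve_right fun h4 => h3 ?_).trans (by rw [add_assoc])
      rw [h4, succ_nsmul]
      congr 1
      abel
    · refine (h2.resolve_left fun h4 => h3 ?_).trans (by rw [sub_eq_add_neg, add_assoc])
      rw [h4, succ_nsmul]
      congr 1
      abel

theorem nsmul_one_eq_zero_iff {m i : ℕ} : i • (1 : Fin (m + 3)) = 0 ↔ m + 3 ∣ i := by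
  have h : i • (1 : Fin (m + 3)) = Fin.ofNat (m + 3) i := by
    induction i with
    | zero => simp
    | succ i ih =>
      rw [succ_nsmul, ih]
      apply Fin.ext
      simp [Fin.val_add]
  rw [h, Fin.ext_iff, Nat.dvd_iff_mod_eq_zero]
  simp

theorem exists_nsmul_one {m : ℕ} (x : Fin (m + 3)) : ∃ i : ℕ, i • (1 : Fin (m + 3)) = x := by
  induction x using Fin.induction with
  | zero => exact ⟨0, by simp⟩
  | succ i ih =>
    obtain ⟨l, hl⟩ := ih
    exact ⟨l + 1, by rw [succ_nsmul, hl, Fin.coeSucc_eq_succ]⟩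

/-- A cycle is determined by its edges. -/
theorem eq_of_cycleEdges_subset {k k' : ℕ} (hk : 3 ≤ k) (hk' : 3 ≤ k') {α : Fin k → Fin n}
    (hα : IsCycleIndex α) {β : Fin k' → Fin n} (hβ : IsCycleIndex β)
    (h : cycleEdges β ⊆ cycleEdges α) :
    (⟨k, α⟩ : Σ k, Fin k → Fin n) = ⟨k', β⟩ := by
  obtain ⟨m, rfl⟩ := Nat.exists_eq_add_of_le' hk
  obtain ⟨m', rfl⟩ := Nat.exists_eq_add_of_le' hk'
  obtain ⟨j, δ, hδ, H⟩ := exists_forall_eq_add_nsmul hα.1 hβ.1 h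
  have hδ0 : ∀ i : ℕ, i • δ = 0 ↔ i • (1 : Fin (m + 3)) = 0 := fun i => by
    rcases hδ with rfl | rfl <;> simp
  -- Both sides of `H` are periodic in `i`, with periods `m' + 3` and `m + 3`.
  have hper : ∀ i : ℕ, m' + 3 ∣ i ↔ m + 3 ∣ i := fun i => by
    rw [← nsmul_one_eq_zero_iff, ← nsmul_one_eq_zero_iff, ← hδ0, ← hβ.1.eq_iff, H,
      ← zero_nsmul (1 : Fin (m' + 3)), H, hα.1.eq_iff]
    simp
  obtain rfl : m' = m := by
    have := Nat.dvd_antisymm ((hper _).2 dvd_rfl) ((hper _).1 dvd_rfl)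
    omega
  obtain ⟨r, hr⟩ : ∃ r, β = α ∘ dihedral j r := by
    rcases hδ with rfl | rfl
    · refine ⟨false, funext fun x => ?_⟩
      obtain ⟨i, rfl⟩ := exists_nsmul_one x
      rw [H]
      rfl
    · refine ⟨true, funext fun x => ?_⟩
      obtain ⟨i, rfl⟩ := exists_nsmul_one x
      rw [H, smul_neg, ← sub_eq_add_neg]
      rfl
  have h1 : IsCycleIndex (α ∘ dihedral (0, false).1 (0, false).2) := by
    convert hα
    ext x
    simp [dihedral]
  have h2 := (existsUnique_dihedral hα.1).unique h1 (y₂ := (j, r)) (hr ▸ hβ)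
  rw [Prod.mk.injEq] at h2
  rw [hr, ← h2.1, ← h2.2]
  congr 1
  ext x
  simp [dihedral]

/-- The union of two distinct cycles with a common edge has more edges than vertices. -/
theorem card_cycleVerts_union_lt {k k' : ℕ} (hk : 3 ≤ k) (hk' : 3 ≤ k') {α : Fin k → Fin n}
    (hα : IsCycleIndex α) {β : Fin k' → Fin n} (hβ : IsCycleIndex β)
    (hne : (⟨k, α⟩ : Σ k, Fin k → Fin n) ≠ ⟨k', β⟩)
    (hd : ¬ Disjoint (cycleEdges α) (cycleEdges β)) :
    (cycleVerts α ∪ cycleVerts β).card < (cycleEdges α ∪ cycleEdges β).card := by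
  suffices H : (cycleEdges α ∩ cycleEdges β).card < (cycleVerts α ∩ cycleVerts β).card by
    have h1 := Finset.card_union_add_card_inter (cycleEdges α) (cycleEdges β)
    have h2 := Finset.card_union_add_card_inter (cycleVerts α) (cycleVerts β)
    rw [card_cycleEdges hk hα.1, card_cycleEdges hk' hβ.1] at h1
    rw [card_cycleVerts hα.1, card_cycleVerts hβ.1] at h2
    omega
  obtain ⟨m, rfl⟩ := Nat.exists_eq_add_of_le' hk
  obtain ⟨m', rfl⟩ := Nat.exists_eq_add_of_le' hk'
  set T : Finset (Fin (m' + 3)) := Finset.univ.filter fun i => s(β i, β (i + 1)) ∈ cycleEdges α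
    with hT
  have hinj := injective_cycle_edge hk' hβ.1
  simp only [finRotate_apply] at hinj
  have hTE : cycleEdges α ∩ cycleEdges β = T.image fun i => s(β i, β (i + 1)) := by
    ext e
    simp only [Finset.mem_inter, Finset.mem_image, hT, Finset.mem_filter, Finset.mem_univ,
      true_and, cycleEdges, finRotate_apply]
    constructor
    · rintro ⟨h1, i, rfl⟩
      exact ⟨i, h1, rfl⟩
    · rintro ⟨i, h1, rfl⟩
      exact ⟨h1, i, rfl⟩
  -- The shared edges of `β` do not exhaust `β`, so one of them is followed by an unshared one.
  obtain ⟨i, hi, hi'⟩ : ∃ i ∈ T, i + 1 ∉ T := by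
    by_contra! hcon
    obtain ⟨i₀, hi₀⟩ : T.Nonempty := by
      rw [Finset.not_disjoint_iff_nonempty_inter, hTE] at hd
      exact Finset.image_nonempty.1 hd
    have hall : ∀ l : ℕ, i₀ + l • 1 ∈ T := fun l => by
      induction l with
      | zero => simpa using hi₀
      | succ l ih =>
        rw [succ_nsmul, ← add_assoc]
        exact hcon _ ih
    refine hne (eq_of_cycleEdges_subset hk hk' hα hβ fun e he => ?_)
    obtain ⟨x, -, rfl⟩ := Finset.mem_image.1 he
    obtain ⟨l, hl⟩ := exists_nsmul_one (x - i₀)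
    have hx := hall l
    rw [hl, add_sub_cancel] at hx
    rw [finRotate_apply]
    exact (Finset.mem_filter.1 hx).2
  have hverts : ∀ i ∈ T, β i ∈ cycleVerts α ∧ β (i + 1) ∈ cycleVerts α := fun i hi => by
    obtain ⟨x, -, hx⟩ := Finset.mem_image.1 (Finset.mem_filter.1 hi).2
    rw [Sym2.eq_iff] at hx
    rcases hx with ⟨h1, h2⟩ | ⟨h1, h2⟩ <;> rw [← h1, ← h2] <;>
      exact ⟨Finset.mem_image_of_mem _ (Finset.mem_univ _),
        Finset.mem_image_of_mem _ (Finset.mem_univ _)⟩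
  rw [hTE, Finset.card_image_of_injective _ hinj]
  calc T.card < (insert (i + 1) T).card := by
        rw [Finset.card_insert_of_notMem hi']
        omega
    _ = ((insert (i + 1) T).image β).card := (Finset.card_image_of_injective _ hβ.1).symm
    _ ≤ _ := by
        refine Finset.card_le_card fun v hv => ?_
        obtain ⟨x, hx, rfl⟩ := Finset.mem_image.1 hv
        refine Finset.mem_inter.2 ⟨?_, Finset.mem_image_of_mem _ (Finset.mem_univ _)⟩
        rcases Finset.mem_insert.1 hx with rfl | hx
        · exact (hverts i hi).2
        · exact (hverts x hx).1

theorem not_disjoint_cycleVerts {k k' : ℕ} {α : Fin k → Fin n} {β : Fin k' → Fin n}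
    (hd : ¬ Disjoint (cycleEdges α) (cycleEdges β)) :
    ¬ Disjoint (cycleVerts α) (cycleVerts β) := by
  obtain ⟨e, h1, h2⟩ := Finset.not_disjoint_iff.1 hd
  obtain ⟨i, -, rfl⟩ := Finset.mem_image.1 h1
  obtain ⟨j, -, hj⟩ := Finset.mem_image.1 h2
  rw [Finset.not_disjoint_iff]
  refine ⟨α i, Finset.mem_image_of_mem _ (Finset.mem_univ _), ?_⟩
  rw [Sym2.eq_iff] at hj
  rcases hj with hj | hj
  · rw [← hj.1]
    exact Finset.mem_image_of_mem _ (Finset.mem_univ _)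
  · rw [← hj.2]
    exact Finset.mem_image_of_mem _ (Finset.mem_univ _)

theorem card_union_lt_of_not_disjoint {ι : Type*} [DecidableEq ι] {s t : Finset ι}
    (h : ¬ Disjoint s t) : (s ∪ t).card < s.card + t.card := by
  have h1 := Finset.card_union_add_card_inter s t
  have h2 := (Finset.not_disjoint_iff_nonempty_inter.1 h).card_pos
  omega

/-! ### Sums over tuples of vertices, graded by the number of distinct entries -/

theorem cycleVerts_cons {k : ℕ} (b : Fin n) (β : Fin k → Fin n) :
    cycleVerts (Fin.cons b β : Fin (k + 1) → Fin n) = insert b (cycleVerts β) := by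
  ext v
  simp [cycleVerts, Fin.exists_fin_succ, eq_comm]

theorem card_cycleVerts_le {k : ℕ} (α : Fin k → Fin n) : (cycleVerts α).card ≤ k :=
  Finset.card_image_le.trans (by simp)

theorem card_cycleVerts_lt {k : ℕ} {α : Fin k → Fin n} (hα : ¬ Function.Injective α) :
    (cycleVerts α).card < k := by
  refine lt_of_le_of_ne (card_cycleVerts_le α) fun h => hα ?_
  have hinj : Set.InjOn α (Finset.univ : Finset (Fin k)) :=
    Finset.card_image_iff.1 (h.trans (Finset.card_fin k).symm)
  exact fun i j hij => hinj (by simp) (by simp) hij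

/-- There are `O(n ^ j)` tuples with `j` entries outside `T`: summed with the weight `1 / n` for
each such entry they contribute a bounded amount. -/
theorem sum_inv_pow_card_le (hn : 1 ≤ n) (T : Finset (Fin n)) (k : ℕ) :
    ∑ β : Fin k → Fin n, ((n : ℝ)⁻¹) ^ (T ∪ cycleVerts β).card ≤
      ((T.card : ℝ) + k) ^ k * ((n : ℝ)⁻¹) ^ T.card := by
  have hn' : (0 : ℝ) < n := by exact_mod_cast hn
  induction k generalizing T with
  | zero => simp [cycleVerts]
  | succ k ih =>
    have hunion : ∀ b (β : Fin k → Fin n),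
        T ∪ cycleVerts (Fin.cons b β : Fin (k + 1) → Fin n) = insert b T ∪ cycleVerts β := by
      intro b β
      rw [cycleVerts_cons]
      ext v
      simp
    have hcons : ∑ γ : Fin (k + 1) → Fin n, ((n : ℝ)⁻¹) ^ (T ∪ cycleVerts γ).card =
        ∑ b, ∑ β : Fin k → Fin n, ((n : ℝ)⁻¹) ^ (insert b T ∪ cycleVerts β).card := by
      simp only [← hunion]
      rw [← Fintype.sum_prod_type']
      exact (Fintype.sum_equiv (Fin.consEquiv fun _ => Fin n) _ _ fun _ => rfl).symm
    rw [hcons]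
    set c : ℝ := ((T.card : ℝ) + (k + 1)) ^ k with hc
    calc ∑ b, ∑ β : Fin k → Fin n, ((n : ℝ)⁻¹) ^ (insert b T ∪ cycleVerts β).card
        ≤ ∑ b, c * ((n : ℝ)⁻¹) ^ (insert b T).card := by
          refine Finset.sum_le_sum fun b _ => (ih _).trans ?_
          have h : ((insert b T).card : ℝ) ≤ T.card + 1 := by
            exact_mod_cast Finset.card_insert_le b T
          refine mul_le_mul_of_nonneg_right ?_ (by positivity)
          exact pow_le_pow_left₀ (by positivity) (by linarith) k
      _ ≤ ∑ b, c * (((n : ℝ)⁻¹) ^ T.card * ((if b ∈ T then 1 else 0) + (n : ℝ)⁻¹)) := by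
          gcongr with b
          by_cases hb : b ∈ T
          · rw [Finset.insert_eq_of_mem hb, if_pos hb]
            exact le_mul_of_one_le_right (by positivity) (by simp)
          · rw [Finset.card_insert_of_notMem hb, if_neg hb, pow_succ, zero_add]
      _ = c * (((n : ℝ)⁻¹) ^ T.card * (T.card + 1)) := by
          rw [← Finset.mul_sum, ← Finset.mul_sum, Finset.sum_add_distrib]
          simp [hn'.ne']
      _ ≤ c * (((n : ℝ)⁻¹) ^ T.card * (T.card + (k + 1))) := by
          gcongr
          linarith [(Nat.cast_nonneg k : (0 : ℝ) ≤ k)]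
      _ = _ := by
          rw [hc]
          push_cast
          ring

theorem sum_inv_pow_card_cycleVerts_le (hn : 1 ≤ n) (k : ℕ) :
    ∑ α : Fin k → Fin n, ((n : ℝ)⁻¹) ^ (cycleVerts α).card ≤ (k : ℝ) ^ k := by
  simpa using sum_inv_pow_card_le hn ∅ k

theorem sum_sum_inv_pow_card_cycleVerts_le (hn : 1 ≤ n) (k k' : ℕ) :
    ∑ α : Fin k → Fin n, ∑ β : Fin k' → Fin n,
      ((n : ℝ)⁻¹) ^ (cycleVerts α ∪ cycleVerts β).card ≤ ((k : ℝ) + k') ^ k' * (k : ℝ) ^ k := by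
  calc _ ≤ ∑ α : Fin k → Fin n, ((k : ℝ) + k') ^ k' * ((n : ℝ)⁻¹) ^ (cycleVerts α).card := by
        refine Finset.sum_le_sum fun α _ => (sum_inv_pow_card_le hn _ _).trans ?_
        gcongr
        exact card_cycleVerts_le α
    _ ≤ _ := by
        rw [← Finset.mul_sum]
        gcongr
        exact sum_inv_pow_card_cycleVerts_le hn k

/-! ### Moments of the weights -/

/-- The weight of a set of vertices. As no vertex lies on more than four of the edges
of two cycles, it dominates the products of weights that occur below. -/
noncomputable def vertWeight (w : Fin n → ℝ) (T : Finset (Fin n)) : ℝ :=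
  ∏ v ∈ T, (1 + w v) ^ 4

theorem vertWeight_nonneg (w : Fin n → ℝ) (T : Finset (Fin n)) : 0 ≤ vertWeight w T :=
  Finset.prod_nonneg fun _ _ => by positivity

/-- A sum over the pairs of tuples of lengths `k` and `k'` that dominates the error terms. Each pair
comes with one factor `1 / n` more than it has vertices, so that the expectation is `O(1 / n)`. -/
noncomputable def overlapSum (k k' : ℕ) (w : Fin n → ℝ) : ℝ :=
  ∑ α : Fin k → Fin n, ∑ β : Fin k' → Fin n,
    ((n : ℝ)⁻¹) ^ ((cycleVerts α ∪ cycleVerts β).card + 1) *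
      vertWeight w (cycleVerts α ∪ cycleVerts β)

theorem overlapSum_nonneg (k k' : ℕ) (w : Fin n → ℝ) : 0 ≤ overlapSum k k' w :=
  Finset.sum_nonneg fun _ _ => Finset.sum_nonneg fun _ _ =>
    mul_nonneg (by positivity) (vertWeight_nonneg _ _)

/-- The normalized sum of `g (w (α 0)) * … * g (w (α (k - 1)))` over the injective tuples `α`. -/
noncomputable def injMean (g : ℝ → ℝ) (k : ℕ) (w : Fin n → ℝ) : ℝ :=
  ((n : ℝ)⁻¹) ^ k * ∑ α : Fin k → Fin n with Function.Injective α, ∏ i, g (w (α i))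

theorem prod_comp_eq_prod_cycleVerts {k : ℕ} {α : Fin k → Fin n} (hα : Function.Injective α)
    (f : Fin n → ℝ) : ∏ i, f (α i) = ∏ v ∈ cycleVerts α, f v := by
  rw [cycleVerts, Finset.prod_image fun i _ j _ h => hα h]

theorem prod_cycleVerts_sq_mul_le {w : Fin n → ℝ} (hw : ∀ i, 0 < w i) (S T : Finset (Fin n)) :
    (∏ v ∈ S, (1 + w v) ^ 2) * (∏ v ∈ T, (1 + w v) ^ 2) ≤ vertWeight w (S ∪ T) := by
  have h1 : ∀ v, 1 ≤ (1 + w v) ^ 2 := fun v => one_le_pow₀ (by linarith [hw v])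
  have h2 : ∀ S' ⊆ S ∪ T, ∏ v ∈ S', (1 + w v) ^ 2 ≤ ∏ v ∈ S ∪ T, (1 + w v) ^ 2 := fun S' hS =>
    Finset.prod_le_prod_of_subset_of_one_le hS (fun _ _ => by positivity) fun v _ _ => h1 v
  calc _ ≤ (∏ v ∈ S ∪ T, (1 + w v) ^ 2) * ∏ v ∈ S ∪ T, (1 + w v) ^ 2 :=
        mul_le_mul (h2 _ Finset.subset_union_left) (h2 _ Finset.subset_union_right)
          (Finset.prod_nonneg fun _ _ => by positivity)
          (Finset.prod_nonneg fun _ _ => by positivity)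
    _ = _ := by
        rw [vertWeight, ← Finset.prod_mul_distrib]
        exact Finset.prod_congr rfl fun v _ => by ring

variable {ν : Measure ℝ} [IsProbabilityMeasure ν]

theorem ae_pi_pos (hpos : ∀ᵐ x ∂ν, 0 < x) :
    ∀ᵐ w ∂(Measure.pi fun _ : Fin n => ν), ∀ i, 0 < w i :=
  ae_all_iff.2 fun i =>
    (Measure.tendsto_eval_ae_ae (μ := fun _ : Fin n => ν) (i := i)).eventually hpos

theorem integrable_one_add_pow (hpos : ∀ᵐ x ∂ν, 0 < x) (h4 : Integrable (fun x => x ^ 4) ν) :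
    Integrable (fun x => (1 + x) ^ 4) ν := by
  refine Integrable.mono' (((integrable_const (1 : ℝ)).add h4).const_mul 8)
    (by fun_prop) ?_
  filter_upwards [hpos] with x hx
  rw [Real.norm_of_nonneg (by positivity)]
  simp only [Pi.add_apply]
  nlinarith [sq_nonneg (x ^ 2 - 1), sq_nonneg (x - 1), sq_nonneg (x ^ 2 - x),
    sq_nonneg (x ^ 2 + x - 2)]

theorem integrable_of_le_sq (hpos : ∀ᵐ x ∂ν, 0 < x) (h4 : Integrable (fun x => x ^ 4) ν)
    {g : ℝ → ℝ} (hg : Measurable g) (hg0 : ∀ x, 0 < x → 0 ≤ g x)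
    (hg1 : ∀ x, 0 < x → g x ≤ (1 + x) ^ 2) : Integrable g ν := by
  refine Integrable.mono' (integrable_one_add_pow hpos h4) hg.aestronglyMeasurable ?_
  filter_upwards [hpos] with x hx
  rw [Real.norm_of_nonneg (hg0 x hx)]
  exact (hg1 x hx).trans (pow_le_pow_right₀ (by linarith) (by norm_num))

theorem integrable_pi_prod {g : ℝ → ℝ} (hg : Integrable g ν) (T : Finset (Fin n)) :
    Integrable (fun w : Fin n → ℝ => ∏ v ∈ T, g (w v)) (Measure.pi fun _ => ν) := by
  have h := Integrable.fintype_prod (μ := fun _ : Fin n => ν)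
    (f := fun i x => if i ∈ T then g x else 1) fun i => by
      by_cases hi : i ∈ T <;> simp [hi, hg]
  simpa [Finset.prod_ite_mem] using h

theorem integral_pi_prod (g : ℝ → ℝ) (T : Finset (Fin n)) :
    ∫ w : Fin n → ℝ, ∏ v ∈ T, g (w v) ∂(Measure.pi fun _ => ν) = (∫ x, g x ∂ν) ^ T.card := by
  have h := integral_fintype_prod_eq_prod (μ := fun _ : Fin n => ν)
    (f := fun i x => if i ∈ T then g x else 1)
  have h2 : ∀ i, ∫ x, (if i ∈ T then g x else 1) ∂ν = if i ∈ T then ∫ x, g x ∂ν else 1 := by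
    intro i
    by_cases hi : i ∈ T <;> simp [hi]
  simp only [h2, Finset.prod_ite_mem, Finset.univ_inter, Finset.prod_const] at h
  exact h

theorem one_le_integral_one_add_pow (hpos : ∀ᵐ x ∂ν, 0 < x)
    (h4 : Integrable (fun x => x ^ 4) ν) : 1 ≤ ∫ x, (1 + x) ^ 4 ∂ν := by
  have h : ∫ _, (1 : ℝ) ∂ν ≤ ∫ x, (1 + x) ^ 4 ∂ν := by
    refine integral_mono_ae (integrable_const _) (integrable_one_add_pow hpos h4) ?_
    filter_upwards [hpos] with x hx
    exact one_le_pow₀ (by linarith)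
  simpa using h

theorem integrable_overlapSum (hpos : ∀ᵐ x ∂ν, 0 < x) (h4 : Integrable (fun x => x ^ 4) ν)
    (k k' : ℕ) : Integrable (overlapSum (n := n) k k') (Measure.pi fun _ => ν) :=
  integrable_finsetSum _ fun _ _ => integrable_finsetSum _ fun _ _ =>
    (integrable_pi_prod (integrable_one_add_pow hpos h4) _).const_mul _

theorem integral_overlapSum_le (hpos : ∀ᵐ x ∂ν, 0 < x) (h4 : Integrable (fun x => x ^ 4) ν)
    (hn : 1 ≤ n) (k k' : ℕ) :
    ∫ w : Fin n → ℝ, overlapSum k k' w ∂(Measure.pi fun _ => ν) ≤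
      (∫ x, (1 + x) ^ 4 ∂ν) ^ (k + k') * (((k : ℝ) + k') ^ k' * (k : ℝ) ^ k) / n := by
  set M := ∫ x, (1 + x) ^ 4 ∂ν with hM
  have hM1 : 1 ≤ M := one_le_integral_one_add_pow hpos h4
  have hint : ∀ T : Finset (Fin n), Integrable (fun w : Fin n → ℝ => vertWeight w T)
      (Measure.pi fun _ => ν) := fun T =>
    integrable_pi_prod (integrable_one_add_pow hpos h4) T
  simp only [overlapSum]
  rw [integral_finsetSum _ fun α _ => integrable_finsetSum _ fun β _ => (hint _).const_mul _]
  calc _ = ∑ α : Fin k → Fin n, ∑ β : Fin k' → Fin n,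
        ((n : ℝ)⁻¹) ^ ((cycleVerts α ∪ cycleVerts β).card + 1) *
          M ^ (cycleVerts α ∪ cycleVerts β).card := by
        refine Finset.sum_congr rfl fun α _ => ?_
        rw [integral_finsetSum _ fun β _ => (hint _).const_mul _]
        refine Finset.sum_congr rfl fun β _ => ?_
        rw [integral_const_mul]
        congr 1
        exact integral_pi_prod (ν := ν) (fun x => (1 + x) ^ 4) _
    _ ≤ ∑ α : Fin k → Fin n, ∑ β : Fin k' → Fin n,
        (n : ℝ)⁻¹ * M ^ (k + k') * ((n : ℝ)⁻¹) ^ (cycleVerts α ∪ cycleVerts β).card := by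
        refine Finset.sum_le_sum fun α _ => Finset.sum_le_sum fun β _ => ?_
        have hcard : (cycleVerts α ∪ cycleVerts β).card ≤ k + k' :=
          (Finset.card_union_le _ _).trans
            (add_le_add (card_cycleVerts_le α) (card_cycleVerts_le β))
        rw [pow_succ, mul_assoc, mul_comm (((n : ℝ)⁻¹) ^ _)]
        gcongr
    _ ≤ (n : ℝ)⁻¹ * M ^ (k + k') * (((k : ℝ) + k') ^ k' * (k : ℝ) ^ k) := by
        simp only [← Finset.mul_sum]
        gcongr
        exact sum_sum_inv_pow_card_cycleVerts_le hn k k'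
    _ = _ := by ring

theorem prod_comp_le {w : Fin n → ℝ} (hw : ∀ i, 0 < w i) {g : ℝ → ℝ}
    (hg0 : ∀ x, 0 < x → 0 ≤ g x) (hg1 : ∀ x, 0 < x → g x ≤ (1 + x) ^ 2) {k : ℕ}
    {α : Fin k → Fin n} (hα : Function.Injective α) :
    ∏ i, g (w (α i)) ≤ ∏ v ∈ cycleVerts α, (1 + w v) ^ 2 := by
  rw [prod_comp_eq_prod_cycleVerts hα fun v => g (w v)]
  exact Finset.prod_le_prod (fun v _ => hg0 _ (hw v)) fun v _ => hg1 _ (hw v)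

theorem prod_mul_prod_comp_le {w : Fin n → ℝ} (hw : ∀ i, 0 < w i) {g : ℝ → ℝ}
    (hg0 : ∀ x, 0 < x → 0 ≤ g x) (hg1 : ∀ x, 0 < x → g x ≤ (1 + x) ^ 2) {k k' : ℕ}
    {α : Fin k → Fin n} (hα : Function.Injective α) {β : Fin k' → Fin n}
    (hβ : Function.Injective β) :
    (∏ i, g (w (α i))) * ∏ i, g (w (β i)) ≤ vertWeight w (cycleVerts α ∪ cycleVerts β) :=
  (mul_le_mul (prod_comp_le hw hg0 hg1 hα) (prod_comp_le hw hg0 hg1 hβ)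
    (Finset.prod_nonneg fun i _ => hg0 _ (hw _))
    (Finset.prod_nonneg fun _ _ => by positivity)).trans
    (prod_cycleVerts_sq_mul_le hw _ _)

theorem integrable_prod_mul_prod_comp (hpos : ∀ᵐ x ∂ν, 0 < x)
    (h4 : Integrable (fun x => x ^ 4) ν) {g : ℝ → ℝ} (hg : Measurable g)
    (hg0 : ∀ x, 0 < x → 0 ≤ g x) (hg1 : ∀ x, 0 < x → g x ≤ (1 + x) ^ 2) {k k' : ℕ}
    {α : Fin k → Fin n} (hα : Function.Injective α) {β : Fin k' → Fin n}
    (hβ : Function.Injective β) :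
    Integrable (fun w : Fin n → ℝ => (∏ i, g (w (α i))) * ∏ i, g (w (β i)))
      (Measure.pi fun _ => ν) := by
  refine Integrable.mono' (g := fun w => vertWeight w (cycleVerts α ∪ cycleVerts β))
    (integrable_pi_prod (integrable_one_add_pow hpos h4) _)
    (by fun_prop) ?_
  filter_upwards [ae_pi_pos hpos] with w hw
  rw [Real.norm_of_nonneg (mul_nonneg (Finset.prod_nonneg fun i _ => hg0 _ (hw _))
    (Finset.prod_nonneg fun i _ => hg0 _ (hw _)))]
  exact prod_mul_prod_comp_le hw hg0 hg1 hα hβ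

open Classical in
theorem injMean_sq_eq (g : ℝ → ℝ) (k : ℕ) (w : Fin n → ℝ) :
    injMean g k w ^ 2 = ∑ α : Fin k → Fin n with Function.Injective α,
      ∑ β : Fin k → Fin n with Function.Injective β,
        ((n : ℝ)⁻¹) ^ (k + k) * ((∏ i, g (w (α i))) * ∏ i, g (w (β i))) := by
  rw [injMean, mul_pow, pow_two (∑ α ∈ _, _), Finset.sum_mul_sum, Finset.mul_sum]
  refine Finset.sum_congr rfl fun α _ => ?_
  rw [Finset.mul_sum]
  refine Finset.sum_congr rfl fun β _ => ?_
  rw [pow_add, pow_two]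

theorem integrable_injMean (hpos : ∀ᵐ x ∂ν, 0 < x)
    (h4 : Integrable (fun x => x ^ 4) ν) {g : ℝ → ℝ} (hg : Measurable g)
    (hg0 : ∀ x, 0 < x → 0 ≤ g x) (hg1 : ∀ x, 0 < x → g x ≤ (1 + x) ^ 2) (k : ℕ) :
    Integrable (injMean (n := n) g k) (Measure.pi fun _ => ν) := by
  classical
  refine (integrable_finsetSum _ fun α hα => ?_).const_mul _
  have h : (fun w : Fin n → ℝ => ∏ i, g (w (α i))) = fun w => ∏ v ∈ cycleVerts α, g (w v) :=
    funext fun w => prod_comp_eq_prod_cycleVerts (Finset.mem_filter.1 hα).2 fun v => g (w v)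
  rw [h]
  exact integrable_pi_prod (integrable_of_le_sq hpos h4 hg hg0 hg1) _

theorem integrable_injMean_sq (hpos : ∀ᵐ x ∂ν, 0 < x)
    (h4 : Integrable (fun x => x ^ 4) ν) {g : ℝ → ℝ} (hg : Measurable g)
    (hg0 : ∀ x, 0 < x → 0 ≤ g x) (hg1 : ∀ x, 0 < x → g x ≤ (1 + x) ^ 2) (k : ℕ) :
    Integrable (fun w : Fin n → ℝ => injMean g k w ^ 2) (Measure.pi fun _ => ν) := by
  classical
  simp only [injMean_sq_eq]
  exact integrable_finsetSum _ fun α hα => integrable_finsetSum _ fun β hβ =>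
    (integrable_prod_mul_prod_comp hpos h4 hg hg0 hg1 (Finset.mem_filter.1 hα).2
      (Finset.mem_filter.1 hβ).2).const_mul _

/-- Up to a relative error `O(1 / n)`, all tuples are injective. -/
theorem abs_integral_injMean_sub_le (hpos : ∀ᵐ x ∂ν, 0 < x)
    (h4 : Integrable (fun x => x ^ 4) ν) {g : ℝ → ℝ} (hg : Measurable g)
    (hg0 : ∀ x, 0 < x → 0 ≤ g x) (hg1 : ∀ x, 0 < x → g x ≤ (1 + x) ^ 2) (hn : 1 ≤ n) (k : ℕ) :
    |∫ w : Fin n → ℝ, injMean g k w ∂(Measure.pi fun _ => ν) - (∫ x, g x ∂ν) ^ k| ≤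
      |∫ x, g x ∂ν| ^ k * (k : ℝ) ^ k / n := by
  classical
  have hn' : (0 : ℝ) < n := by exact_mod_cast hn
  set a := ∫ x, g x ∂ν with ha
  have hint : ∀ α : Fin k → Fin n, Function.Injective α →
      Integrable (fun w : Fin n → ℝ => ∏ i, g (w (α i))) (Measure.pi fun _ => ν) ∧
      ∫ w : Fin n → ℝ, ∏ i, g (w (α i)) ∂(Measure.pi fun _ => ν) = a ^ k := fun α hα => by
    have h : (fun w : Fin n → ℝ => ∏ i, g (w (α i))) =
        fun w => ∏ v ∈ cycleVerts α, g (w v) :=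
      funext fun w => prod_comp_eq_prod_cycleVerts hα fun v => g (w v)
    rw [h]
    refine ⟨integrable_pi_prod (integrable_of_le_sq hpos h4 hg hg0 hg1) _, ?_⟩
    rw [integral_pi_prod, card_cycleVerts hα]
  have h1 : ∫ w : Fin n → ℝ, injMean g k w ∂(Measure.pi fun _ => ν) =
      ∑ α : Fin k → Fin n with Function.Injective α, ((n : ℝ)⁻¹) ^ k * a ^ k := by
    simp only [injMean]
    rw [integral_const_mul, integral_finsetSum _ fun α hα => (hint α (Finset.mem_filter.1 hα).2).1,
      Finset.mul_sum]
    exact Finset.sum_congr rfl fun α hα => by rw [(hint α (Finset.mem_filter.1 hα).2).2]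
  have h2 : a ^ k = ∑ α : Fin k → Fin n, ((n : ℝ)⁻¹) ^ k * a ^ k := by
    simp only [Finset.sum_const, Finset.card_univ, Fintype.card_pi, Fintype.card_fin,
      Finset.prod_const, nsmul_eq_mul]
    push_cast
    rw [← mul_assoc, ← mul_pow, mul_inv_cancel₀ hn'.ne', one_pow, one_mul]
  rw [h1]
  nth_rw 2 [h2]
  rw [← Finset.sum_filter_add_sum_filter_not Finset.univ fun α : Fin k → Fin n =>
    Function.Injective α, sub_add_cancel_left, abs_neg]
  calc |∑ α : Fin k → Fin n with ¬ Function.Injective α, ((n : ℝ)⁻¹) ^ k * a ^ k|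
      ≤ ∑ α : Fin k → Fin n with ¬ Function.Injective α, |a| ^ k * ((n : ℝ)⁻¹) ^ k := by
        refine (Finset.abs_sum_le_sum_abs _ _).trans (Finset.sum_le_sum fun α _ => ?_)
        rw [abs_mul, abs_pow, abs_pow, abs_of_nonneg (by positivity : (0 : ℝ) ≤ (n : ℝ)⁻¹),
          mul_comm]
    _ ≤ ∑ α : Fin k → Fin n with ¬ Function.Injective α,
        |a| ^ k * (((n : ℝ)⁻¹) ^ (cycleVerts α).card * (n : ℝ)⁻¹) := by
        refine Finset.sum_le_sum fun α hα => ?_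
        rw [← pow_succ]
        refine mul_le_mul_of_nonneg_left ?_ (by positivity)
        exact pow_le_pow_of_le_one (by positivity) (inv_le_one_of_one_le₀ (by exact_mod_cast hn))
          (card_cycleVerts_lt (Finset.mem_filter.1 hα).2)
    _ ≤ ∑ α : Fin k → Fin n, |a| ^ k * (((n : ℝ)⁻¹) ^ (cycleVerts α).card * (n : ℝ)⁻¹) :=
        Finset.sum_le_sum_of_subset_of_nonneg (Finset.filter_subset _ _)
          fun α _ _ => by positivity
    _ = |a| ^ k * ((∑ α : Fin k → Fin n, ((n : ℝ)⁻¹) ^ (cycleVerts α).card) * (n : ℝ)⁻¹) := by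
        rw [← Finset.mul_sum, ← Finset.sum_mul]
    _ ≤ |a| ^ k * ((k : ℝ) ^ k * (n : ℝ)⁻¹) := by
        gcongr
        exact sum_inv_pow_card_cycleVerts_le hn k
    _ = _ := by ring

/-- Pairs of tuples without a common vertex are independent; all the others are negligible. -/
theorem integral_injMean_sq_le (hpos : ∀ᵐ x ∂ν, 0 < x)
    (h4 : Integrable (fun x => x ^ 4) ν) {g : ℝ → ℝ} (hg : Measurable g)
    (hg0 : ∀ x, 0 < x → 0 ≤ g x) (hg1 : ∀ x, 0 < x → g x ≤ (1 + x) ^ 2) (hn : 1 ≤ n) (k : ℕ) :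
    ∫ w : Fin n → ℝ, injMean g k w ^ 2 ∂(Measure.pi fun _ => ν) ≤
      (∫ x, g x ∂ν) ^ (k + k) +
        ∫ w : Fin n → ℝ, overlapSum k k w ∂(Measure.pi fun _ => ν) := by
  classical
  have hn' : (0 : ℝ) < n := by exact_mod_cast hn
  set a := ∫ x, g x ∂ν with ha
  have ha0 : 0 ≤ a := integral_nonneg_of_ae (by
    filter_upwards [hpos] with x hx
    exact hg0 x hx)
  set P : (Fin k → Fin n) → (Fin k → Fin n) → Prop := fun α β =>
    Function.Injective α ∧ Function.Injective β ∧ Disjoint (cycleVerts α) (cycleVerts β) with hP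
  set F : (Fin k → Fin n) → (Fin k → Fin n) → (Fin n → ℝ) → ℝ := fun α β w =>
    if P α β then ((n : ℝ)⁻¹) ^ (k + k) * ∏ v ∈ cycleVerts α ∪ cycleVerts β, g (w v) else 0
    with hF
  have hFint : ∀ α β, Integrable (F α β) (Measure.pi fun _ => ν) := fun α β => by
    by_cases h : P α β
    · simp only [hF, if_pos h]
      exact (integrable_pi_prod (integrable_of_le_sq hpos h4 hg hg0 hg1) _).const_mul _
    · simp only [hF, if_neg h]
      exact integrable_zero _ _ _
  have hFle : ∀ α β, ∫ w, F α β w ∂(Measure.pi fun _ => ν) ≤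
      ((n : ℝ)⁻¹) ^ (k + k) * a ^ (k + k) := by
    intro α β
    by_cases h : P α β
    · simp only [hF, if_pos h]
      rw [integral_const_mul, integral_pi_prod, Finset.card_union_of_disjoint h.2.2,
        card_cycleVerts h.1, card_cycleVerts h.2.1]
    · simp only [hF, if_neg h, integral_zero]
      positivity
  have hsplit : ∀ᵐ w ∂(Measure.pi fun _ : Fin n => ν), injMean g k w ^ 2 ≤
      (∑ α, ∑ β, F α β w) + overlapSum k k w := by
    filter_upwards [ae_pi_pos hpos] with w hw
    have hterm : ∀ α β : Fin k → Fin n, 0 ≤ (F α β w + ((n : ℝ)⁻¹) ^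
        ((cycleVerts α ∪ cycleVerts β).card + 1) * vertWeight w (cycleVerts α ∪ cycleVerts β)) := by
      intro α β
      refine add_nonneg ?_ (mul_nonneg (by positivity) (vertWeight_nonneg _ _))
      simp only [hF]
      split_ifs
      · exact mul_nonneg (by positivity) (Finset.prod_nonneg fun v _ => hg0 _ (hw v))
      · exact le_rfl
    rw [injMean_sq_eq, overlapSum, ← Finset.sum_add_distrib]
    simp only [← Finset.sum_add_distrib]
    refine (Finset.sum_le_sum fun α hα => ?_).trans
      (Finset.sum_le_sum_of_subset_of_nonneg (Finset.filter_subset _ _)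
        fun α _ _ => Finset.sum_nonneg fun β _ => hterm α β)
    refine (Finset.sum_le_sum fun β hβ => ?_).trans
      (Finset.sum_le_sum_of_subset_of_nonneg (Finset.filter_subset _ _)
        fun β _ _ => hterm α β)
    have hα' := (Finset.mem_filter.1 hα).2
    have hβ' := (Finset.mem_filter.1 hβ).2
    by_cases hd : Disjoint (cycleVerts α) (cycleVerts β)
    · simp only [hF, hP, hα', hβ', hd, and_self, if_true]
      rw [prod_comp_eq_prod_cycleVerts hα' fun v => g (w v),
        prod_comp_eq_prod_cycleVerts hβ' fun v => g (w v), ← Finset.prod_union hd]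
      exact le_add_of_nonneg_right (mul_nonneg (by positivity) (vertWeight_nonneg _ _))
    · simp only [hF, hP, hd, and_false, if_false, zero_add]
      have hcard := card_union_lt_of_not_disjoint hd
      rw [card_cycleVerts hα', card_cycleVerts hβ'] at hcard
      refine mul_le_mul ?_ (prod_mul_prod_comp_le hw hg0 hg1 hα' hβ')
        (mul_nonneg (Finset.prod_nonneg fun i _ => hg0 _ (hw _))
          (Finset.prod_nonneg fun i _ => hg0 _ (hw _))) (by positivity)
      exact pow_le_pow_of_le_one (by positivity) (inv_le_one_of_one_le₀ (by exact_mod_cast hn))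
        hcard
  have hFsum : Integrable (fun w => ∑ α, ∑ β, F α β w) (Measure.pi fun _ : Fin n => ν) :=
    integrable_finsetSum _ fun α _ => integrable_finsetSum _ fun β _ => hFint α β
  calc _ ≤ ∫ w : Fin n → ℝ, ((∑ α, ∑ β, F α β w) + overlapSum k k w) ∂(Measure.pi fun _ => ν) :=
        integral_mono_ae (integrable_injMean_sq hpos h4 hg hg0 hg1 k)
          (hFsum.add (integrable_overlapSum hpos h4 k k)) hsplit
    _ = (∑ α, ∑ β, ∫ w, F α β w ∂(Measure.pi fun _ => ν)) +
        ∫ w : Fin n → ℝ, overlapSum k k w ∂(Measure.pi fun _ => ν) := by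
        rw [integral_add hFsum (integrable_overlapSum hpos h4 k k),
          integral_finsetSum _ fun α _ => integrable_finsetSum _ fun β _ => hFint α β]
        congr 1
        exact Finset.sum_congr rfl fun α _ => integral_finsetSum _ fun β _ => hFint α β
    _ ≤ (∑ α : Fin k → Fin n, ∑ β : Fin k → Fin n, ((n : ℝ)⁻¹) ^ (k + k) * a ^ (k + k)) +
        ∫ w : Fin n → ℝ, overlapSum k k w ∂(Measure.pi fun _ => ν) := by
        gcongr with α _ β _
        exact hFle α β
    _ = _ := by
        congr 1
        simp only [Finset.sum_const, Finset.card_univ, Fintype.card_pi, Fintype.card_fin,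
          Finset.prod_const, nsmul_eq_mul]
        push_cast
        rw [← mul_assoc, ← mul_assoc, ← pow_add, ← mul_pow, mul_inv_cancel₀ hn'.ne', one_pow,
          one_mul]

/-- The averages over injective tuples have mean squared deviation `O(1 / n)`. This is the place
that needs fourth moments when `g x = x ^ 2`. -/
theorem exists_integral_injMean_sub_sq_le (hpos : ∀ᵐ x ∂ν, 0 < x)
    (h4 : Integrable (fun x => x ^ 4) ν) {g : ℝ → ℝ} (hg : Measurable g)
    (hg0 : ∀ x, 0 < x → 0 ≤ g x) (hg1 : ∀ x, 0 < x → g x ≤ (1 + x) ^ 2) (k : ℕ) :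
    ∃ C : ℝ, 0 ≤ C ∧ ∀ n : ℕ, 1 ≤ n →
      Integrable (fun w : Fin n → ℝ => (injMean g k w - (∫ x, g x ∂ν) ^ k) ^ 2)
        (Measure.pi fun _ => ν) ∧
      ∫ w : Fin n → ℝ, (injMean g k w - (∫ x, g x ∂ν) ^ k) ^ 2 ∂(Measure.pi fun _ => ν) ≤
        C / n := by
  set a := ∫ x, g x ∂ν with ha
  set M := ∫ x, (1 + x) ^ 4 ∂ν with hM
  have hM1 : 1 ≤ M := one_le_integral_one_add_pow hpos h4
  have ha0 : 0 ≤ a := integral_nonneg_of_ae (by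
    filter_upwards [hpos] with x hx
    exact hg0 x hx)
  refine ⟨M ^ (k + k) * (((k : ℝ) + k) ^ k * (k : ℝ) ^ k) + 2 * a ^ k * (|a| ^ k * (k : ℝ) ^ k),
    by positivity, fun n hn => ?_⟩
  have hi1 := integrable_injMean (n := n) hpos h4 hg hg0 hg1 k
  have hi2 := integrable_injMean_sq (n := n) hpos h4 hg hg0 hg1 k
  have heq : ∀ w : Fin n → ℝ, (injMean g k w - a ^ k) ^ 2 =
      injMean g k w ^ 2 - 2 * a ^ k * injMean g k w + a ^ (k + k) := fun w => by ring
  have hi3 : Integrable (fun w : Fin n → ℝ => injMean g k w ^ 2 - 2 * a ^ k * injMean g k w)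
    (Measure.pi fun _ => ν) := hi2.sub (hi1.const_mul _)
  simp only [heq]
  refine ⟨hi3.add (integrable_const _), ?_⟩
  rw [integral_add hi3 (integrable_const _), integral_sub hi2 (hi1.const_mul _),
    integral_const_mul, integral_const]
  simp only [probReal_univ, smul_eq_mul, one_mul]
  have h1 := (integral_injMean_sq_le hpos h4 hg hg0 hg1 hn k).trans
    (add_le_add_right (integral_overlapSum_le hpos h4 hn k k) _)
  have h2 := neg_le_of_abs_le (abs_integral_injMean_sub_le hpos h4 hg hg0 hg1 hn k)
  have h3 := mul_le_mul_of_nonneg_left h2 (by positivity : 0 ≤ 2 * a ^ k)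
  rw [← ha, ← hM] at *
  calc _ ≤ a ^ (k + k) + M ^ (k + k) * (((k : ℝ) + k) ^ k * (k : ℝ) ^ k) / n -
        2 * a ^ k * (∫ w : Fin n → ℝ, injMean g k w ∂(Measure.pi fun _ => ν)) + a ^ (k + k) := by
        gcongr
    _ ≤ a ^ (k + k) + M ^ (k + k) * (((k : ℝ) + k) ^ k * (k : ℝ) ^ k) / n +
        2 * a ^ k * (|a| ^ k * (k : ℝ) ^ k / n - a ^ k) + a ^ (k + k) := by
        linarith
    _ = _ := by
        rw [pow_add a]
        ring

/-! ### The Stein–Chen error for cycles -/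

open Classical in
/-- The possible cycles whose lengths lie in `A`. -/
noncomputable def cycleIndices (n : ℕ) (A : Finset ℕ) : Finset (Σ k, Fin k → Fin n) :=
  A.sigma fun _ => Finset.univ.filter IsCycleIndex

theorem mem_cycleIndices {A : Finset ℕ} {a : Σ k, Fin k → Fin n} :
    a ∈ cycleIndices n A ↔ a.1 ∈ A ∧ IsCycleIndex a.2 := by
  simp [cycleIndices]

theorem cycleCount_eq_copyCount (A : Finset ℕ) (G : SimpleGraph (Fin n)) :
    cycleCount A G = copyCount (cycleIndices n A) (fun a => cycleEdges a.2) G := by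
  classical
  simp only [cycleCount, copyCount, cycleIndices, Finset.card_filter, Finset.sum_sigma,
    Finset.sum_filter, ite_and, cycleExists_iff]

/-- The function `(1 + w i) * (1 + w j)` of the unordered pair of `i` and `j`. Up to a factor
`O(1 / n)` it bounds the edge probabilities, and it is at least `1`. -/
noncomputable def pairWeight (w : Fin n → ℝ) : Sym2 (Fin n) → ℝ :=
  Sym2.lift ⟨fun i j => (1 + w i) * (1 + w j), fun _ _ => mul_comm _ _⟩

theorem one_le_pairWeight {w : Fin n → ℝ} (hw : ∀ i, 0 < w i) (e : Sym2 (Fin n)) :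
    1 ≤ pairWeight w e := by
  induction e with
  | _ i j => exact one_le_mul_of_one_le_of_one_le (by linarith [hw i]) (by linarith [hw j])

theorem mul_div_sum_le {w : Fin n → ℝ} (hw : ∀ i, 0 < w i) {c : ℝ}
    (hc : (∑ l, w l)⁻¹ ≤ c * (n : ℝ)⁻¹) (i j : Fin n) :
    w i * w j / ∑ l, w l ≤ c * (n : ℝ)⁻¹ * ((1 + w i) * (1 + w j)) := by
  have hL : 0 ≤ ∑ l, w l := Finset.sum_nonneg fun l _ => (hw l).le
  rw [div_eq_mul_inv, mul_comm]
  have := hw i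
  have := hw j
  exact mul_le_mul hc (mul_le_mul (by linarith) (by linarith) (by linarith) (by linarith))
    (by positivity) ((inv_nonneg.2 hL).trans hc)

theorem pairProb_le {w : Fin n → ℝ} (hw : ∀ i, 0 < w i) {c : ℝ}
    (hc : (∑ l, w l)⁻¹ ≤ c * (n : ℝ)⁻¹) (e : Sym2 (Fin n)) :
    pairProb w e ≤ c * (n : ℝ)⁻¹ * pairWeight w e := by
  induction e with
  | _ i j =>
    refine le_trans ?_ (mul_div_sum_le hw hc i j)
    have hL : 0 < ∑ l, w l := Finset.sum_pos (fun l _ => hw l) ⟨i, Finset.mem_univ _⟩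
    have := mul_pos (hw i) (hw j)
    exact div_le_div_of_nonneg_left this.le hL (by linarith)

theorem prod_pairProb_le {w : Fin n → ℝ} (hw : ∀ i, 0 < w i) {c : ℝ}
    (hc : (∑ l, w l)⁻¹ ≤ c * (n : ℝ)⁻¹) (E : Finset (Sym2 (Fin n))) :
    ∏ e ∈ E, pairProb w e ≤ (c * (n : ℝ)⁻¹) ^ E.card * ∏ e ∈ E, pairWeight w e := by
  rw [← Finset.prod_const, ← Finset.prod_mul_distrib]
  exact Finset.prod_le_prod (fun e _ => (pairProb_mem_Icc hw e).1) fun e _ => pairProb_le hw hc e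

theorem prod_comp_finRotate {k : ℕ} {M : Type*} [CommMonoid M] (f : Fin k → M) :
    ∏ i, f i * f (finRotate k i) = ∏ i, f i ^ 2 := by
  rw [Finset.prod_mul_distrib, Equiv.prod_comp (finRotate k) f, ← Finset.prod_mul_distrib]
  simp only [pow_two]

theorem prod_pairWeight_cycleEdges {k : ℕ} (hk : 3 ≤ k) (w : Fin n → ℝ) {α : Fin k → Fin n}
    (hα : Function.Injective α) :
    ∏ e ∈ cycleEdges α, pairWeight w e = ∏ v ∈ cycleVerts α, (1 + w v) ^ 2 := by
  rw [prod_cycleEdges hk hα, ← prod_comp_eq_prod_cycleVerts hα fun v => (1 + w v) ^ 2]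
  exact prod_comp_finRotate fun i => 1 + w (α i)

theorem prod_union_le_mul_prod {ι : Type*} [DecidableEq ι] {f : ι → ℝ} (hf : ∀ i, 1 ≤ f i)
    (S T : Finset ι) : ∏ i ∈ S ∪ T, f i ≤ (∏ i ∈ S, f i) * ∏ i ∈ T, f i := by
  rw [← Finset.prod_union_inter]
  exact le_mul_of_one_le_right
    (Finset.prod_nonneg fun i _ => zero_le_one.trans (hf i)) (Finset.one_le_prod fun i _ => hf i)

theorem mul_inv_pow_le {c : ℝ} (hc1 : 1 ≤ c) (hn : 1 ≤ n) {a b d : ℕ} (hab : a ≤ b)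
    (hbd : b ≤ d) : (c * (n : ℝ)⁻¹) ^ b ≤ c ^ d * ((n : ℝ)⁻¹) ^ a := by
  rw [mul_pow]
  have : (n : ℝ)⁻¹ ≤ 1 := inv_le_one_of_one_le₀ (by exact_mod_cast hn)
  exact mul_le_mul (pow_le_pow_right₀ hc1 hbd)
    (pow_le_pow_of_le_one (by positivity) this hab) (by positivity) (by positivity)

/-- The two terms of the Stein–Chen bound for a pair of cycles with a common edge. The first one has
`a.1 + b.1` edge factors, more than there are vertices, as some vertex is shared. -/
theorem stein_chen_pair_le {w : Fin n → ℝ} (hw : ∀ i, 0 < w i) (hn : 1 ≤ n) {c : ℝ}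
    (hc1 : 1 ≤ c) (hc : (∑ l, w l)⁻¹ ≤ c * (n : ℝ)⁻¹)
    [DecidableEq (Σ k, Fin k → Fin n)] {a b : Σ k, Fin k → Fin n} (ha3 : 3 ≤ a.1)
    (hb3 : 3 ≤ b.1) (ha : IsCycleIndex a.2) (hb : IsCycleIndex b.2)
    (hd : ¬ Disjoint (cycleEdges a.2) (cycleEdges b.2)) :
    (∏ e ∈ cycleEdges a.2, pairProb w e) * (∏ e ∈ cycleEdges b.2, pairProb w e) +
        (if b = a then 0 else ∏ e ∈ cycleEdges a.2 ∪ cycleEdges b.2, pairProb w e) ≤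
      2 * c ^ (a.1 + b.1) * (((n : ℝ)⁻¹) ^ ((cycleVerts a.2 ∪ cycleVerts b.2).card + 1) *
        vertWeight w (cycleVerts a.2 ∪ cycleVerts b.2)) := by
  set V := cycleVerts a.2 ∪ cycleVerts b.2 with hV
  have hc0 : 0 ≤ c * (n : ℝ)⁻¹ := by positivity
  have hprod : (∏ e ∈ cycleEdges a.2, pairWeight w e) * (∏ e ∈ cycleEdges b.2, pairWeight w e) ≤
      vertWeight w V := by
    rw [prod_pairWeight_cycleEdges ha3 w ha.1, prod_pairWeight_cycleEdges hb3 w hb.1]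
    exact prod_cycleVerts_sq_mul_le hw _ _
  have hpos : ∀ E : Finset (Sym2 (Fin n)), 0 ≤ ∏ e ∈ E, pairWeight w e := fun E =>
    Finset.prod_nonneg fun e _ => zero_le_one.trans (one_le_pairWeight hw e)
  have hcard : V.card < a.1 + b.1 := by
    have := card_union_lt_of_not_disjoint (not_disjoint_cycleVerts hd)
    rwa [card_cycleVerts ha.1, card_cycleVerts hb.1] at this
  have h1 : (∏ e ∈ cycleEdges a.2, pairProb w e) * (∏ e ∈ cycleEdges b.2, pairProb w e) ≤
      c ^ (a.1 + b.1) * ((n : ℝ)⁻¹) ^ (V.card + 1) * vertWeight w V := by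
    calc _ ≤ ((c * (n : ℝ)⁻¹) ^ (cycleEdges a.2).card * ∏ e ∈ cycleEdges a.2, pairWeight w e) *
          ((c * (n : ℝ)⁻¹) ^ (cycleEdges b.2).card * ∏ e ∈ cycleEdges b.2, pairWeight w e) :=
          mul_le_mul (prod_pairProb_le hw hc _) (prod_pairProb_le hw hc _)
            (Finset.prod_nonneg fun e _ => (pairProb_mem_Icc hw e).1)
            (mul_nonneg (by positivity) (hpos _))
      _ = (c * (n : ℝ)⁻¹) ^ (a.1 + b.1) * ((∏ e ∈ cycleEdges a.2, pairWeight w e) *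
          ∏ e ∈ cycleEdges b.2, pairWeight w e) := by
          rw [card_cycleEdges ha3 ha.1, card_cycleEdges hb3 hb.1]
          ring
      _ ≤ _ := mul_le_mul (mul_inv_pow_le hc1 hn hcard le_rfl) hprod
          (mul_nonneg (hpos _) (hpos _)) (by positivity)
  have h2 : (if b = a then 0 else ∏ e ∈ cycleEdges a.2 ∪ cycleEdges b.2, pairProb w e) ≤
      c ^ (a.1 + b.1) * ((n : ℝ)⁻¹) ^ (V.card + 1) * vertWeight w V := by
    split_ifs with hab
    · exact mul_nonneg (by positivity) (vertWeight_nonneg _ _)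
    · refine (prod_pairProb_le hw hc _).trans (mul_le_mul ?_ ?_ (hpos _) (by positivity))
      · refine mul_inv_pow_le hc1 hn
          (card_cycleVerts_union_lt ha3 hb3 ha hb (fun h => hab h.symm) hd) ?_
        refine (Finset.card_union_le _ _).trans ?_
        rw [card_cycleEdges ha3 ha.1, card_cycleEdges hb3 hb.1]
      · exact (prod_union_le_mul_prod (one_le_pairWeight hw) _ _).trans hprod
  calc _ ≤ _ := add_le_add h1 h2
    _ = _ := by ring

theorem sum_stein_chen_le {w : Fin n → ℝ} (hw : ∀ i, 0 < w i) (hn : 1 ≤ n) {c : ℝ}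
    (hc1 : 1 ≤ c) (hc : (∑ l, w l)⁻¹ ≤ c * (n : ℝ)⁻¹) {A : Finset ℕ} (hA : ∀ k ∈ A, 3 ≤ k)
    [DecidableEq (Σ k, Fin k → Fin n)] :
    ∑ a ∈ cycleIndices n A, ∑ b ∈ cycleIndices n A with
        ¬ Disjoint (cycleEdges a.2) (cycleEdges b.2),
      ((∏ e ∈ cycleEdges a.2, pairProb w e) * (∏ e ∈ cycleEdges b.2, pairProb w e) +
        if b = a then 0 else ∏ e ∈ cycleEdges a.2 ∪ cycleEdges b.2, pairProb w e) ≤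
      ∑ k ∈ A, ∑ k' ∈ A, 2 * c ^ (k + k') * overlapSum k k' w := by
  classical
  set Φ : (Σ k, Fin k → Fin n) → (Σ k, Fin k → Fin n) → ℝ := fun a b =>
    2 * c ^ (a.1 + b.1) * (((n : ℝ)⁻¹) ^ ((cycleVerts a.2 ∪ cycleVerts b.2).card + 1) *
        vertWeight w (cycleVerts a.2 ∪ cycleVerts b.2)) with hΦ
  have hΦ0 : ∀ a b, 0 ≤ Φ a b := fun a b =>
    mul_nonneg (by positivity) (mul_nonneg (by positivity) (vertWeight_nonneg _ _))
  have hsub : cycleIndices n A ⊆ A.sigma fun _ => Finset.univ := fun a ha => by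
    simp [(mem_cycleIndices.1 ha).1]
  calc _ ≤ ∑ a ∈ cycleIndices n A, ∑ b ∈ cycleIndices n A with
        ¬ Disjoint (cycleEdges a.2) (cycleEdges b.2), Φ a b := by
        refine Finset.sum_le_sum fun a ha => Finset.sum_le_sum fun b hb => ?_
        obtain ⟨ha1, ha2⟩ := mem_cycleIndices.1 ha
        obtain ⟨hb1, hb2⟩ := mem_cycleIndices.1 (Finset.mem_filter.1 hb).1
        exact stein_chen_pair_le hw hn hc1 hc (hA _ ha1) (hA _ hb1) ha2 hb2
          (Finset.mem_filter.1 hb).2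
    _ ≤ ∑ a ∈ A.sigma fun _ => Finset.univ, ∑ b ∈ A.sigma fun _ => Finset.univ, Φ a b := by
        refine (Finset.sum_le_sum fun a _ => ?_).trans
          (Finset.sum_le_sum_of_subset_of_nonneg hsub
            fun a _ _ => Finset.sum_nonneg fun b _ => hΦ0 a b)
        exact Finset.sum_le_sum_of_subset_of_nonneg ((Finset.filter_subset _ _).trans hsub)
          fun b _ _ => hΦ0 a b
    _ = _ := by
        rw [Finset.sum_sigma]
        refine Finset.sum_congr rfl fun k _ => ?_
        simp only [Finset.sum_sigma]
        rw [Finset.sum_comm]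
        refine Finset.sum_congr rfl fun k' _ => ?_
        simp only [hΦ, overlapSum, Finset.mul_sum]

/-! ### The conditional Poisson parameter -/

/-- Given the weights, the expected number of cycles whose lengths lie in `A`. -/
noncomputable def condRate (A : Finset ℕ) (w : Fin n → ℝ) : ℝ :=
  ∑ a ∈ cycleIndices n A, ∏ e ∈ cycleEdges a.2, pairProb w e

theorem condRate_nonneg {w : Fin n → ℝ} (hw : ∀ i, 0 < w i) (A : Finset ℕ) :
    0 ≤ condRate A w :=
  Finset.sum_nonneg fun _ _ => Finset.prod_nonneg fun e _ => (pairProb_mem_Icc hw e).1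

theorem prod_sub_prod_div_one_add_mem_Icc {ι : Type*} (s : Finset ι) {y : ι → ℝ}
    (hy : ∀ i, 0 ≤ y i) :
    ∏ i ∈ s, y i - ∏ i ∈ s, y i / (1 + y i) ∈
      Set.Icc 0 ((∏ i ∈ s, y i) * ∑ i ∈ s, y i) := by
  have hP : 0 ≤ ∏ i ∈ s, y i := Finset.prod_nonneg fun i _ => hy i
  constructor
  · rw [sub_nonneg]
    exact Finset.prod_le_prod (fun i _ => div_nonneg (hy i) (by linarith [hy i]))
      fun i _ => div_le_self (hy i) (by linarith [hy i])
  · have h1 : 1 - ∑ i ∈ s, y i ≤ (∏ i ∈ s, (1 + y i))⁻¹ := by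
      have h2 : ∏ i ∈ s, (1 + y i) ≤ Real.exp (∑ i ∈ s, y i) := by
        rw [Real.exp_sum]
        exact Finset.prod_le_prod (fun i _ => by linarith [hy i]) fun i _ => by
          linarith [Real.add_one_le_exp (y i)]
      have h3 : 0 < ∏ i ∈ s, (1 + y i) := Finset.prod_pos fun i _ => by linarith [hy i]
      calc 1 - ∑ i ∈ s, y i ≤ Real.exp (-∑ i ∈ s, y i) := by
            linarith [Real.add_one_le_exp (-∑ i ∈ s, y i)]
        _ = (Real.exp (∑ i ∈ s, y i))⁻¹ := Real.exp_neg _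
        _ ≤ _ := inv_anti₀ h3 h2
    rw [Finset.prod_div_distrib, div_eq_mul_inv]
    nlinarith

/-- The parameter `condRate` with all the denominators `w i * w j + L` replaced by `L`, in terms of
`injMean`. -/
theorem sum_prod_sq_div_eq {w : Fin n → ℝ} (hn : 1 ≤ n) {A : Finset ℕ} (hA : ∀ k ∈ A, 3 ≤ k) :
    ∑ a ∈ cycleIndices n A, ∏ i, w (a.2 i) * w (a.2 (finRotate _ i)) / ∑ l, w l =
      ∑ k ∈ A, 1 / (2 * (k : ℝ)) * (injMean (fun x => x ^ 2) k w * ((∑ l, w l) / n)⁻¹ ^ k) := by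
  classical
  have hn' : (n : ℝ) ≠ 0 := by positivity
  rw [cycleIndices, Finset.sum_sigma]
  refine Finset.sum_congr rfl fun k hk => ?_
  obtain ⟨m, rfl⟩ := Nat.exists_eq_add_of_le' (hA k hk)
  have h1 := sum_injective_eq_two_mul_sum_isCycleIndex (n := n)
    (fun α : Fin (m + 3) → Fin n => ∏ i, w (α i) ^ 2) fun α j r => by
      simp only [Function.comp_apply]
      exact Equiv.prod_comp (dihedral j r) fun i => w (α i) ^ 2
  have h2 : ∀ α : Fin (m + 3) → Fin n,
      ∏ i, w (α i) * w (α (finRotate _ i)) / ∑ l, w l =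
        (∏ i, w (α i) ^ 2) * (∑ l, w l)⁻¹ ^ (m + 3) := fun α => by
    rw [Finset.prod_div_distrib, prod_comp_finRotate fun i => w (α i), Finset.prod_const,
      Finset.card_univ, Fintype.card_fin, div_eq_mul_inv, inv_pow]
  simp only [h2, ← Finset.sum_mul]
  rw [injMean]
  rw [h1, inv_div, div_eq_mul_inv (n : ℝ) (∑ l, w l), mul_pow]
  have h3 : ((m + 3 : ℕ) : ℝ) ≠ 0 := by positivity
  have h4 : ((n : ℝ)⁻¹) ^ (m + 3) * (n : ℝ) ^ (m + 3) = 1 := by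
    rw [← mul_pow, inv_mul_cancel₀ hn', one_pow]
  set S := ∑ α : Fin (m + 3) → Fin n with IsCycleIndex α, ∏ i, w (α i) ^ 2
  calc S * (∑ l, w l)⁻¹ ^ (m + 3) =
      (1 / (2 * ((m + 3 : ℕ) : ℝ)) * (2 * ((m + 3 : ℕ) : ℝ))) *
        (((n : ℝ)⁻¹) ^ (m + 3) * (n : ℝ) ^ (m + 3)) * (S * (∑ l, w l)⁻¹ ^ (m + 3)) := by
        rw [h4]
        field_simp
    _ = _ := by ring

/-- Replacing the denominators `w i * w j + L` by `L` is a negligible change. -/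
theorem sub_condRate_mem_Icc {w : Fin n → ℝ} (hw : ∀ i, 0 < w i) (hn : 1 ≤ n) {c : ℝ}
    (hc1 : 1 ≤ c) (hc : (∑ l, w l)⁻¹ ≤ c * (n : ℝ)⁻¹) {A : Finset ℕ} (hA : ∀ k ∈ A, 3 ≤ k) :
    ∑ k ∈ A, 1 / (2 * (k : ℝ)) * (injMean (fun x => x ^ 2) k w * ((∑ l, w l) / n)⁻¹ ^ k) -
      condRate A w ∈ Set.Icc 0 (∑ k ∈ A, k * c ^ (k + 1) * overlapSum k k w) := by
  classical
  have hn' : (0 : ℝ) < n := by exact_mod_cast hn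
  have hL : 0 < ∑ l, w l := Finset.sum_pos (fun l _ => hw l) ⟨⟨0, hn⟩, Finset.mem_univ _⟩
  have hc0 : 0 ≤ c * (n : ℝ)⁻¹ := by positivity
  rw [← sum_prod_sq_div_eq hn hA, condRate, ← Finset.sum_sub_distrib]
  set y : ∀ a : Σ k, Fin k → Fin n, Fin a.1 → ℝ := fun a i =>
    w (a.2 i) * w (a.2 (finRotate _ i)) / ∑ l, w l with hy
  have hy0 : ∀ a i, 0 ≤ y a i := fun a i =>
    div_nonneg (mul_pos (hw _) (hw _)).le hL.le
  have hprob : ∀ a ∈ cycleIndices n A,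
      ∏ e ∈ cycleEdges a.2, pairProb w e = ∏ i, y a i / (1 + y a i) := fun a ha => by
    obtain ⟨ha1, ha2⟩ := mem_cycleIndices.1 ha
    rw [prod_cycleEdges (hA _ ha1) ha2.1]
    refine Finset.prod_congr rfl fun i _ => ?_
    simp only [pairProb, Sym2.lift_mk, edgeProb, hy]
    have := mul_pos (hw (a.2 i)) (hw (a.2 (finRotate _ i)))
    field_simp
    ring
  have hmem := fun a (ha : a ∈ cycleIndices n A) =>
    hprob a ha ▸ prod_sub_prod_div_one_add_mem_Icc Finset.univ (hy0 a)
  refine ⟨Finset.sum_nonneg fun a ha => (hmem a ha).1, ?_⟩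
  set Φ : (Σ k, Fin k → Fin n) → ℝ := fun a =>
    a.1 * c ^ (a.1 + 1) * (((n : ℝ)⁻¹) ^ ((cycleVerts a.2 ∪ cycleVerts a.2).card + 1) *
        vertWeight w (cycleVerts a.2 ∪ cycleVerts a.2)) with hΦ
  have hΦ0 : ∀ a, 0 ≤ Φ a := fun a =>
    mul_nonneg (by positivity) (mul_nonneg (by positivity) (vertWeight_nonneg _ _))
  have hterm : ∀ a ∈ cycleIndices n A, (∏ i, y a i) * ∑ i, y a i ≤ Φ a := by
    intro a ha
    obtain ⟨ha1, ha2⟩ := mem_cycleIndices.1 ha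
    have hle : ∀ i, y a i ≤ c * (n : ℝ)⁻¹ * pairWeight w s(a.2 i, a.2 (finRotate _ i)) := fun i =>
      mul_div_sum_le hw hc _ _
    set P := ∏ v ∈ cycleVerts a.2, (1 + w v) ^ 2 with hP
    have hPe : ∏ i, pairWeight w s(a.2 i, a.2 (finRotate _ i)) = P := by
      rw [← prod_cycleEdges (hA _ ha1) ha2.1, prod_pairWeight_cycleEdges (hA _ ha1) w ha2.1]
    have hP0 : 0 ≤ P := Finset.prod_nonneg fun _ _ => by positivity
    have h1 : ∏ i, y a i ≤ (c * (n : ℝ)⁻¹) ^ a.1 * P := by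
      rw [← hPe]
      refine (Finset.prod_le_prod (fun i _ => hy0 a i) fun i _ => hle i).trans_eq ?_
      rw [Finset.prod_mul_distrib, Finset.prod_const, Finset.card_fin]
    have h2 : ∑ i, y a i ≤ a.1 * (c * (n : ℝ)⁻¹ * P) := by
      calc ∑ i, y a i ≤ ∑ _i : Fin a.1, c * (n : ℝ)⁻¹ * P := by
            refine Finset.sum_le_sum fun i _ => (hle i).trans ?_
            refine mul_le_mul_of_nonneg_left ?_ hc0
            rw [← hPe, ← Finset.prod_singleton (fun i =>
              pairWeight w s(a.2 i, a.2 (finRotate _ i))) i]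
            exact Finset.prod_le_prod_of_subset_of_one_le (Finset.subset_univ _)
              (fun i _ => zero_le_one.trans (one_le_pairWeight hw _))
              fun i _ _ => one_le_pairWeight hw _
        _ = _ := by simp
    calc _ ≤ (c * (n : ℝ)⁻¹) ^ a.1 * P * (a.1 * (c * (n : ℝ)⁻¹ * P)) :=
          mul_le_mul h1 h2 (Finset.sum_nonneg fun i _ => hy0 a i)
            (mul_nonneg (by positivity) hP0)
      _ = a.1 * c ^ (a.1 + 1) * (((n : ℝ)⁻¹) ^ (a.1 + 1) * (P * P)) := by ring
      _ ≤ Φ a := by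
          simp only [hΦ]
          have h3 : (cycleVerts a.2 ∪ cycleVerts a.2).card = a.1 := by
            rw [Finset.union_self, card_cycleVerts ha2.1]
          rw [h3]
          gcongr
          exact prod_cycleVerts_sq_mul_le hw _ _
  calc _ ≤ ∑ a ∈ cycleIndices n A, Φ a :=
        Finset.sum_le_sum fun a ha => (hmem a ha).2.trans (hterm a ha)
    _ ≤ ∑ a ∈ A.sigma fun _ => Finset.univ, Φ a :=
        Finset.sum_le_sum_of_subset_of_nonneg
          (fun a ha => by simp [(mem_cycleIndices.1 ha).1]) fun a _ _ => hΦ0 a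
    _ ≤ _ := by
        rw [Finset.sum_sigma]
        refine Finset.sum_le_sum fun k _ => ?_
        simp only [hΦ, ← Finset.mul_sum]
        refine mul_le_mul_of_nonneg_left ?_ (by positivity)
        refine Finset.sum_le_sum fun α _ => ?_
        exact Finset.single_le_sum (f := fun β : Fin k → Fin n =>
          ((n : ℝ)⁻¹) ^ ((cycleVerts α ∪ cycleVerts β).card + 1) *
            vertWeight w (cycleVerts α ∪ cycleVerts β))
          (fun β _ => mul_nonneg (by positivity) (vertWeight_nonneg _ _)) (Finset.mem_univ α)

/-! ### Expansion of the Poisson parameter around its limit -/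

theorem inv_sub_inv_eq {m l : ℝ} (hm : 0 < m) (hl : m / 2 ≤ l) :
    l⁻¹ = m⁻¹ - m⁻¹ * l⁻¹ * (l - m) := by
  have : 0 < l := by linarith
  field_simp
  ring

theorem inv_le_two_mul_inv {m l : ℝ} (hm : 0 < m) (hl : m / 2 ≤ l) : l⁻¹ ≤ 2 * m⁻¹ := by
  calc l⁻¹ ≤ (m / 2)⁻¹ := inv_anti₀ (by linarith) hl
    _ = 2 * m⁻¹ := by rw [inv_div, div_eq_mul_inv]

theorem exists_abs_inv_pow_sub_le {m : ℝ} (hm : 0 < m) (k : ℕ) :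
    ∃ C : ℝ, 0 ≤ C ∧ ∀ l, m / 2 ≤ l → |l⁻¹ ^ k - m⁻¹ ^ k| ≤ C * |l - m| := by
  induction k with
  | zero => exact ⟨0, le_rfl, fun l _ => by simp⟩
  | succ k ih =>
    obtain ⟨C, hC, h⟩ := ih
    refine ⟨2 * m⁻¹ * C + m⁻¹ ^ k * (m⁻¹ * (2 * m⁻¹)), by positivity, fun l hl => ?_⟩
    have hl0 : 0 < l := by linarith
    have hz := inv_le_two_mul_inv hm hl
    have heq : l⁻¹ ^ (k + 1) - m⁻¹ ^ (k + 1) =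
        l⁻¹ * (l⁻¹ ^ k - m⁻¹ ^ k) - m⁻¹ ^ k * (m⁻¹ * l⁻¹ * (l - m)) := by
      have := inv_sub_inv_eq hm hl
      linear_combination (m⁻¹ ^ k) * this
    rw [heq]
    calc _ ≤ |l⁻¹ * (l⁻¹ ^ k - m⁻¹ ^ k)| + |m⁻¹ ^ k * (m⁻¹ * l⁻¹ * (l - m))| := abs_sub _ _
      _ = l⁻¹ * |l⁻¹ ^ k - m⁻¹ ^ k| + m⁻¹ ^ k * (m⁻¹ * l⁻¹ * |l - m|) := by
          simp only [abs_mul, abs_pow, abs_inv, abs_of_pos hl0, abs_of_pos hm]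
      _ ≤ 2 * m⁻¹ * (C * |l - m|) + m⁻¹ ^ k * (m⁻¹ * (2 * m⁻¹) * |l - m|) := by
          gcongr
          exact h l hl
      _ = _ := by ring

theorem exists_abs_inv_pow_taylor_le {m : ℝ} (hm : 0 < m) (k : ℕ) :
    ∃ C : ℝ, 0 ≤ C ∧ ∀ l, m / 2 ≤ l →
      |l⁻¹ ^ k - m⁻¹ ^ k + k * m⁻¹ ^ (k + 1) * (l - m)| ≤ C * (l - m) ^ 2 := by
  induction k with
  | zero => exact ⟨0, le_rfl, fun l _ => by simp⟩
  | succ k ih =>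
    obtain ⟨C, hC, h⟩ := ih
    refine ⟨2 * m⁻¹ * C + (k + 1) * m⁻¹ ^ (k + 2) * (2 * m⁻¹), by positivity, fun l hl => ?_⟩
    have hl0 : 0 < l := by linarith
    have hz := inv_le_two_mul_inv hm hl
    have heq : l⁻¹ ^ (k + 1) - m⁻¹ ^ (k + 1) + (k + 1 : ℕ) * m⁻¹ ^ (k + 1 + 1) * (l - m) =
        l⁻¹ * (l⁻¹ ^ k - m⁻¹ ^ k + k * m⁻¹ ^ (k + 1) * (l - m)) +
          (k + 1) * m⁻¹ ^ (k + 2) * (l⁻¹ * (l - m) ^ 2) := by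
      have := inv_sub_inv_eq hm hl
      push_cast
      linear_combination (m⁻¹ ^ k - (k + 1) * m⁻¹ ^ (k + 1) * (l - m)) * this
    rw [heq]
    calc _ ≤ |l⁻¹ * (l⁻¹ ^ k - m⁻¹ ^ k + k * m⁻¹ ^ (k + 1) * (l - m))| +
          |(k + 1) * m⁻¹ ^ (k + 2) * (l⁻¹ * (l - m) ^ 2)| := abs_add_le _ _
      _ = l⁻¹ * |l⁻¹ ^ k - m⁻¹ ^ k + k * m⁻¹ ^ (k + 1) * (l - m)| +
          (k + 1) * m⁻¹ ^ (k + 2) * (l⁻¹ * (l - m) ^ 2) := by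
          have h1 : 0 ≤ ((k : ℝ) + 1) * m⁻¹ ^ (k + 2) * (l⁻¹ * (l - m) ^ 2) := by positivity
          rw [abs_mul l⁻¹, abs_of_pos (inv_pos.2 hl0), abs_of_nonneg h1]
      _ ≤ 2 * m⁻¹ * (C * (l - m) ^ 2) + (k + 1) * m⁻¹ ^ (k + 2) * (2 * m⁻¹ * (l - m) ^ 2) := by
          gcongr
          exact h l hl
      _ = _ := by ring

/-- The linear part, at `(u, l) = (a, m)`, of `u * l⁻¹ ^ k`. -/
noncomputable def mulInvPowLin (m a : ℝ) (k : ℕ) (u l : ℝ) : ℝ :=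
  m⁻¹ ^ k * (u - a) - a * (k * m⁻¹ ^ (k + 1)) * (l - m)

theorem add_mul_sq_le (a b x y : ℝ) :
    (a * x + b * y) ^ 2 ≤ 2 * (a ^ 2 + b ^ 2) * (x ^ 2 + y ^ 2) := by
  nlinarith [sq_nonneg (a * x - b * y), sq_nonneg (a * y), sq_nonneg (b * x)]

theorem exists_mulInvPow_expansion {m : ℝ} (hm : 0 < m) (a : ℝ) (k : ℕ) :
    ∃ C : ℝ, 0 ≤ C ∧ (∀ u l, mulInvPowLin m a k u l ^ 2 ≤ C * ((l - m) ^ 2 + (u - a) ^ 2)) ∧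
      ∀ u l, m / 2 ≤ l →
        |u * l⁻¹ ^ k - a * m⁻¹ ^ k - mulInvPowLin m a k u l| ≤
          C * ((l - m) ^ 2 + (u - a) ^ 2) ∧
        (u * l⁻¹ ^ k - a * m⁻¹ ^ k) ^ 2 ≤ C * ((l - m) ^ 2 + (u - a) ^ 2) := by
  obtain ⟨C₁, hC₁, h1⟩ := exists_abs_inv_pow_sub_le hm k
  obtain ⟨C₂, hC₂, h2⟩ := exists_abs_inv_pow_taylor_le hm k
  set D₁ := 2 * ((m⁻¹ ^ k) ^ 2 + (a * (k * m⁻¹ ^ (k + 1))) ^ 2) with hD₁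
  set D₂ := C₁ + |a| * C₂ with hD₂
  set D₃ := 2 * (((2 * m⁻¹) ^ k) ^ 2 + (|a| * C₁) ^ 2) with hD₃
  have hD₁0 : 0 ≤ D₁ := by positivity
  have hD₂0 : 0 ≤ D₂ := by positivity
  have hD₃0 : 0 ≤ D₃ := by positivity
  refine ⟨D₁ + D₂ + D₃, by positivity, fun u l => ?_, fun u l hl => ⟨?_, ?_⟩⟩
  · have := add_mul_sq_le (m⁻¹ ^ k) (-(a * (k * m⁻¹ ^ (k + 1)))) (u - a) (l - m)
    calc _ = (m⁻¹ ^ k * (u - a) + -(a * (k * m⁻¹ ^ (k + 1))) * (l - m)) ^ 2 := by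
          rw [mulInvPowLin]
          ring
      _ ≤ D₁ * ((l - m) ^ 2 + (u - a) ^ 2) := by
          rw [hD₁]
          linarith
      _ ≤ _ := mul_le_mul_of_nonneg_right (by linarith) (by positivity)
  · have heq : u * l⁻¹ ^ k - a * m⁻¹ ^ k - mulInvPowLin m a k u l =
        (u - a) * (l⁻¹ ^ k - m⁻¹ ^ k) +
          a * (l⁻¹ ^ k - m⁻¹ ^ k + k * m⁻¹ ^ (k + 1) * (l - m)) := by
      rw [mulInvPowLin]
      ring
    rw [heq]
    calc _ ≤ |u - a| * (C₁ * |l - m|) + |a| * (C₂ * (l - m) ^ 2) := by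
          refine (abs_add_le _ _).trans ?_
          rw [abs_mul, abs_mul]
          gcongr
          · exact h1 l hl
          · exact h2 l hl
      _ ≤ D₂ * ((l - m) ^ 2 + (u - a) ^ 2) := by
          have h3 : |u - a| * |l - m| ≤ (l - m) ^ 2 + (u - a) ^ 2 := by
            rw [← sq_abs (l - m), ← sq_abs (u - a)]
            nlinarith [sq_nonneg (|u - a| - |l - m|), sq_nonneg (|u - a|), sq_nonneg (|l - m|)]
          have h4 := mul_le_mul_of_nonneg_left h3 hC₁
          have h5 : 0 ≤ |a| * C₂ * (u - a) ^ 2 := by positivity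
          rw [hD₂]
          nlinarith
      _ ≤ _ := mul_le_mul_of_nonneg_right (by linarith) (by positivity)
  · have hl0 : 0 < l := by linarith
    have heq : u * l⁻¹ ^ k - a * m⁻¹ ^ k = l⁻¹ ^ k * (u - a) + a * (l⁻¹ ^ k - m⁻¹ ^ k) := by ring
    have hle : |u * l⁻¹ ^ k - a * m⁻¹ ^ k| ≤ (2 * m⁻¹) ^ k * |u - a| + |a| * C₁ * |l - m| := by
      rw [heq]
      refine (abs_add_le _ _).trans ?_
      rw [abs_mul, abs_mul, abs_of_pos (by positivity : 0 < l⁻¹ ^ k), mul_assoc |a|]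
      gcongr
      · exact inv_le_two_mul_inv hm hl
      · exact h1 l hl
    calc _ = |u * l⁻¹ ^ k - a * m⁻¹ ^ k| ^ 2 := (sq_abs _).symm
      _ ≤ ((2 * m⁻¹) ^ k * |u - a| + |a| * C₁ * |l - m|) ^ 2 := by gcongr
      _ ≤ D₃ * (|u - a| ^ 2 + |l - m| ^ 2) := add_mul_sq_le _ _ _ _
      _ = D₃ * ((l - m) ^ 2 + (u - a) ^ 2) := by
          rw [sq_abs, sq_abs]
          ring
      _ ≤ _ := mul_le_mul_of_nonneg_right (by linarith) (by positivity)

/-- The approximate Poisson parameter: `u k` stands for the `k`-th normalized sum over injective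
tuples of products of squared weights, and `l` for the mean weight. -/
noncomputable def rateFun (A : Finset ℕ) (u : ℕ → ℝ) (l : ℝ) : ℝ :=
  ∑ k ∈ A, 1 / (2 * (k : ℝ)) * (u k * l⁻¹ ^ k)

/-- The linear part of `rateFun` at the limiting values. -/
noncomputable def rateLin (A : Finset ℕ) (m s : ℝ) (u : ℕ → ℝ) (l : ℝ) : ℝ :=
  ∑ k ∈ A, 1 / (2 * (k : ℝ)) * mulInvPowLin m (s ^ k) k (u k) l

/-- The squared distance of `(u, l)` from the limiting values. -/
def sqDev (A : Finset ℕ) (m s : ℝ) (u : ℕ → ℝ) (l : ℝ) : ℝ :=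
  (l - m) ^ 2 + ∑ k ∈ A, (u k - s ^ k) ^ 2

theorem sqDev_nonneg (A : Finset ℕ) (m s : ℝ) (u : ℕ → ℝ) (l : ℝ) : 0 ≤ sqDev A m s u l :=
  add_nonneg (sq_nonneg _) (Finset.sum_nonneg fun _ _ => sq_nonneg _)

theorem sq_add_sq_le_sqDev {A : Finset ℕ} {k : ℕ} (hk : k ∈ A) (m s : ℝ) (u : ℕ → ℝ) (l : ℝ) :
    (l - m) ^ 2 + (u k - s ^ k) ^ 2 ≤ sqDev A m s u l := by
  have h := Finset.single_le_sum (f := fun k => (u k - s ^ k) ^ 2)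
    (fun _ _ => sq_nonneg _) hk
  have h' : (u k - s ^ k) ^ 2 ≤ ∑ k ∈ A, (u k - s ^ k) ^ 2 := h
  rw [sqDev]
  linarith

/-- The second-order expansion of `rateFun` on `m / 2 ≤ l`. The bound on the linear part holds for
all `l`, so that it can be used for the exceptional weights too. -/
theorem exists_rateFun_expansion {m : ℝ} (hm : 0 < m) (s : ℝ) (A : Finset ℕ) :
    ∃ C : ℝ, 0 ≤ C ∧ (∀ u l, rateLin A m s u l ^ 2 ≤ C * sqDev A m s u l) ∧
      ∀ u l, m / 2 ≤ l →
        |rateFun A u l - rateFun A (fun k => s ^ k) m - rateLin A m s u l| ≤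
          C * sqDev A m s u l ∧
        (rateFun A u l - rateFun A (fun k => s ^ k) m) ^ 2 ≤ C * sqDev A m s u l := by
  choose C hC h1 h2 using fun k => exists_mulInvPow_expansion hm (s ^ k) k
  set D₁ := ∑ k ∈ A, 1 / (2 * (k : ℝ)) * C k with hD₁
  set D₂ := (A.card : ℝ) * ∑ k ∈ A, (1 / (2 * (k : ℝ))) ^ 2 * C k with hD₂
  have hD₁0 : 0 ≤ D₁ := Finset.sum_nonneg fun k _ => mul_nonneg (by positivity) (hC k)
  have hD₂0 : 0 ≤ D₂ := mul_nonneg (by positivity)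
    (Finset.sum_nonneg fun k _ => mul_nonneg (by positivity) (hC k))
  have hsq : ∀ (f : ℕ → ℝ) (u : ℕ → ℝ) (l : ℝ),
      (∀ k ∈ A, f k ^ 2 ≤ C k * ((l - m) ^ 2 + (u k - s ^ k) ^ 2)) →
      (∑ k ∈ A, 1 / (2 * (k : ℝ)) * f k) ^ 2 ≤ D₂ * sqDev A m s u l := by
    intro f u l hf
    calc _ ≤ (A.card : ℝ) * ∑ k ∈ A, (1 / (2 * (k : ℝ)) * f k) ^ 2 := sq_sum_le_card_mul_sum_sq
      _ ≤ (A.card : ℝ) * ∑ k ∈ A, (1 / (2 * (k : ℝ))) ^ 2 * C k * sqDev A m s u l := by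
          refine mul_le_mul_of_nonneg_left (Finset.sum_le_sum fun k hk => ?_) (by positivity)
          rw [mul_pow, mul_assoc]
          exact mul_le_mul_of_nonneg_left ((hf k hk).trans
            (mul_le_mul_of_nonneg_left (sq_add_sq_le_sqDev hk m s u l) (hC k))) (by positivity)
      _ = _ := by rw [← Finset.sum_mul, hD₂, mul_assoc]
  refine ⟨D₁ + D₂, by positivity, fun u l => ?_, fun u l hl => ⟨?_, ?_⟩⟩
  · exact (hsq _ u l fun k _ => h1 k (u k) l).trans
      (mul_le_mul_of_nonneg_right (by linarith) (sqDev_nonneg _ _ _ _ _))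
  · refine le_trans ?_ (mul_le_mul_of_nonneg_right (by linarith : D₁ ≤ D₁ + D₂)
      (sqDev_nonneg _ _ _ _ _))
    rw [rateFun, rateFun, rateLin, ← Finset.sum_sub_distrib, ← Finset.sum_sub_distrib, hD₁,
      Finset.sum_mul]
    refine (Finset.abs_sum_le_sum_abs _ _).trans (Finset.sum_le_sum fun k hk => ?_)
    rw [← mul_sub, ← mul_sub, abs_mul, abs_of_nonneg (by positivity : 0 ≤ 1 / (2 * (k : ℝ))),
      mul_assoc]
    exact mul_le_mul_of_nonneg_left (((h2 k (u k) l hl).1).trans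
      (mul_le_mul_of_nonneg_left (sq_add_sq_le_sqDev hk m s u l) (hC k))) (by positivity)
  · refine le_trans ?_ (mul_le_mul_of_nonneg_right (by linarith : D₂ ≤ D₁ + D₂)
      (sqDev_nonneg _ _ _ _ _))
    rw [rateFun, rateFun, ← Finset.sum_sub_distrib]
    simp only [← mul_sub]
    exact hsq _ u l fun k _ => (h2 k (u k) l hl).2

theorem rateFun_le {m : ℝ} (hm : 0 < m) {s : ℝ} (hs : 0 ≤ s) {A : Finset ℕ} {u : ℕ → ℝ} {l : ℝ}
    (hl : m / 2 ≤ l) (hu : ∀ k ∈ A, |u k - s ^ k| ≤ 1) :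
    rateFun A u l ≤ rateFun A (fun k => s ^ k + 1) (m / 2) := by
  have hl0 : 0 < l := by linarith
  refine Finset.sum_le_sum fun k hk => mul_le_mul_of_nonneg_left ?_ (by positivity)
  have h1 : u k ≤ s ^ k + 1 := by linarith [(abs_le.1 (hu k hk)).2]
  have h2 : l⁻¹ ^ k ≤ (m / 2)⁻¹ ^ k :=
    pow_le_pow_left₀ (by positivity) (inv_anti₀ (by linarith) hl) k
  exact mul_le_mul h1 h2 (by positivity) (by positivity)

/-! ### The conditional law of the cycle count -/

/-- The normalized sums over injective tuples of `k` vertices of the products of the squared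
weights; they concentrate around `E[W²] ^ k`. -/
noncomputable def sqMeans (w : Fin n → ℝ) (k : ℕ) : ℝ :=
  injMean (fun x => x ^ 2) k w

/-- The mean of the weights `w`. -/
noncomputable def meanWeight (w : Fin n → ℝ) : ℝ :=
  (∑ l, w l) / n

/-- A quantity with expectation `O(1 / n)` that controls all the errors. -/
noncomputable def errorTerm (A : Finset ℕ) (m s : ℝ) (w : Fin n → ℝ) : ℝ :=
  sqDev A m s (sqMeans w) (meanWeight w) + ∑ k ∈ A, ∑ k' ∈ A, overlapSum k k' w

theorem graphMean_indicator_mem_Icc {w : Fin n → ℝ} (hw : ∀ i, 0 < w i) (B : Set ℕ)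
    (S : SimpleGraph (Fin n) → ℕ) :
    graphMean w (fun G => B.indicator 1 (S G)) ∈ Set.Icc (0 : ℝ) 1 := by
  have h : ∀ k, B.indicator (1 : ℕ → ℝ) k ∈ Set.Icc (0 : ℝ) 1 := fun k => by
    by_cases hk : k ∈ B <;> simp [hk]
  refine ⟨Finset.sum_nonneg fun H _ => mul_nonneg (graphProb_nonneg hw H) (h _).1, ?_⟩
  rw [← graphMean_const w 1]
  exact graphMean_mono hw fun G => (h _).2

/-- When the mean weight is not too small, the conditional law of the cycle count is close to the
Poisson law with parameter `rateFun`. -/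
theorem abs_graphMean_sub_poissonMean_rateFun_le {w : Fin n → ℝ} (hw : ∀ i, 0 < w i)
    (hn : 1 ≤ n) {N : ℕ} {A : Finset ℕ} (hA : A ⊆ Finset.Icc 3 N) {m T : ℝ} (hm : 0 < m)
    (hl : m / 2 ≤ meanWeight w) (hT : rateFun A (sqMeans w) (meanWeight w) ≤ T) (B : Set ℕ) :
    |graphMean w (fun G => B.indicator 1 (cycleCount A G)) -
        poissonMean (B.indicator 1) (rateFun A (sqMeans w) (meanWeight w))| ≤
      (4 * Real.exp T * max 1 (2 * m⁻¹) ^ (N + N) + 2 * (N * max 1 (2 * m⁻¹) ^ (N + 1))) *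
        ∑ k ∈ A, ∑ k' ∈ A, overlapSum k k' w := by
  classical
  have hn' : (0 : ℝ) < n := by exact_mod_cast hn
  have hA3 : ∀ k ∈ A, 3 ≤ k := fun k hk => (Finset.mem_Icc.1 (hA hk)).1
  have hAN : ∀ k ∈ A, k ≤ N := fun k hk => (Finset.mem_Icc.1 (hA hk)).2
  set c := max 1 (2 * m⁻¹) with hc
  have hc1 : 1 ≤ c := le_max_left _ _
  have hcL : (∑ l, w l)⁻¹ ≤ c * (n : ℝ)⁻¹ := by
    have h1 : (∑ l, w l)⁻¹ = (meanWeight w)⁻¹ * (n : ℝ)⁻¹ := by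
      rw [meanWeight, inv_div, div_eq_mul_inv, mul_comm (n : ℝ), mul_assoc,
        mul_inv_cancel₀ hn'.ne', mul_one]
    rw [h1]
    gcongr
    exact (inv_le_two_mul_inv hm hl).trans (le_max_right _ _)
  set R := ∑ k ∈ A, ∑ k' ∈ A, overlapSum k k' w with hR
  set τ := rateFun A (sqMeans w) (meanWeight w) with hτ
  obtain ⟨hd0, hd1⟩ := sub_condRate_mem_Icc hw hn hc1 hcL hA3
  have hτeq : ∑ k ∈ A, 1 / (2 * (k : ℝ)) *
      (injMean (fun x => x ^ 2) k w * ((∑ l, w l) / n)⁻¹ ^ k) = τ := rfl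
  rw [hτeq] at hd0 hd1
  have ht0 := condRate_nonneg hw A
  have h1 : |graphMean w (fun G => B.indicator 1 (cycleCount A G)) -
      poissonMean (B.indicator 1) (condRate A w)| ≤ 4 * Real.exp T * c ^ (N + N) * R := by
    simp only [cycleCount_eq_copyCount]
    refine (abs_graphMean_copyCount_sub_poissonMean_le hw (cycleIndices n A)
      (fun a => cycleEdges a.2) (fun a ha e he => ?_) (fun a ha => ?_) B rfl).trans ?_
    · obtain ⟨ha1, ha2⟩ := mem_cycleIndices.1 ha
      exact not_isDiag_of_mem_cycleEdges (hA3 _ ha1) ha2.1 he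
    · exact nonempty_cycleEdges (hA3 _ (mem_cycleIndices.1 ha).1) _
    · have hle : ∑ k ∈ A, ∑ k' ∈ A, 2 * c ^ (k + k') * overlapSum k k' w ≤
          2 * c ^ (N + N) * R := by
        rw [hR, Finset.mul_sum]
        refine Finset.sum_le_sum fun k hk => ?_
        rw [Finset.mul_sum]
        refine Finset.sum_le_sum fun k' hk' => ?_
        refine mul_le_mul_of_nonneg_right ?_ (overlapSum_nonneg _ _ _)
        gcongr
        · exact hAN k hk
        · exact hAN k' hk'
      have hexp : Real.exp (condRate A w) ≤ Real.exp T := Real.exp_le_exp.2 (by linarith)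
      calc _ ≤ 2 * Real.exp (condRate A w) *
            ∑ k ∈ A, ∑ k' ∈ A, 2 * c ^ (k + k') * overlapSum k k' w :=
            mul_le_mul_of_nonneg_left (sum_stein_chen_le hw hn hc1 hcL hA3) (by positivity)
        _ ≤ 2 * Real.exp T * (2 * c ^ (N + N) * R) := by
            refine mul_le_mul (by linarith) hle ?_ (by positivity)
            exact Finset.sum_nonneg fun k _ => Finset.sum_nonneg fun k' _ =>
              mul_nonneg (by positivity) (overlapSum_nonneg _ _ _)
        _ = _ := by ring
  have h2 : |poissonMean (B.indicator 1) (condRate A w) - poissonMean (B.indicator 1) τ| ≤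
      2 * (N * c ^ (N + 1)) * R := by
    refine (abs_poissonMean_sub_le (abs_indicator_one_le B) (by linarith : 0 ≤ τ) ht0).trans ?_
    rw [abs_sub_comm, abs_of_nonneg hd0, mul_one, mul_assoc]
    refine mul_le_mul_of_nonneg_left (hd1.trans ?_) zero_le_two
    rw [hR, Finset.mul_sum]
    refine Finset.sum_le_sum fun k hk => ?_
    refine mul_le_mul ?_ ?_ (overlapSum_nonneg _ _ _) (by positivity)
    · have := hAN k hk
      gcongr
    · exact Finset.single_le_sum (f := fun k' => overlapSum k k' w)
        (fun _ _ => overlapSum_nonneg _ _ _) hk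
  calc _ ≤ _ := abs_sub_le _ (poissonMean (B.indicator 1) (condRate A w)) _
    _ ≤ _ := add_le_add h1 h2
    _ = _ := by ring

/-- Up to the error term, the conditional law of the cycle count is the limiting Poisson law plus
a term linear in the deviations of the weight averages from their limits. -/
theorem exists_abs_graphMean_taylor_le {m s : ℝ} (hm : 0 < m) (hs : 0 ≤ s) {N : ℕ}
    {A : Finset ℕ} (hA : A ⊆ Finset.Icc 3 N) :
    ∃ C : ℝ, 0 ≤ C ∧ ∀ (n : ℕ) (w : Fin n → ℝ), 1 ≤ n → (∀ i, 0 < w i) → ∀ B : Set ℕ,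
      |graphMean w (fun G => B.indicator 1 (cycleCount A G)) -
          poissonMean (B.indicator 1) (rateFun A (fun k => s ^ k) m) -
          poissonMean (fun k => B.indicator 1 (k + 1) - B.indicator 1 k)
            (rateFun A (fun k => s ^ k) m) * rateLin A m s (sqMeans w) (meanWeight w)| ≤
        C * errorTerm A m s w := by
  obtain ⟨C₁, hC₁, hlin, hexp⟩ := exists_rateFun_expansion hm s A
  set T := rateFun A (fun k => s ^ k + 1) (m / 2) with hT
  set C₂ := 4 * Real.exp T * max 1 (2 * m⁻¹) ^ (N + N) + 2 * (N * max 1 (2 * m⁻¹) ^ (N + 1))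
    with hC₂
  have hC₂0 : 0 ≤ C₂ := by positivity
  set C₃ := 4 / m ^ 2 + 1 with hC₃
  have hC₃0 : 0 ≤ C₃ := by positivity
  refine ⟨C₂ + 6 * C₁ + (2 * C₃ + C₁), by positivity, fun n w hn hw B => ?_⟩
  set l := meanWeight w with hl
  set u := sqMeans w with hu
  set lam := rateFun A (fun k => s ^ k) m with hlam
  set q := sqDev A m s u l with hq
  set R := ∑ k ∈ A, ∑ k' ∈ A, overlapSum k k' w with hR
  set b : ℕ → ℝ := B.indicator 1 with hb
  have hb1 : ∀ k, |b k| ≤ 1 := abs_indicator_one_le B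
  set H := graphMean w (fun G => b (cycleCount A G)) with hH
  set d := poissonMean (fun k => b (k + 1) - b k) lam with hd
  set lin := rateLin A m s u l with hlinv
  have hq0 : 0 ≤ q := sqDev_nonneg _ _ _ _ _
  have hR0 : 0 ≤ R := Finset.sum_nonneg fun _ _ => Finset.sum_nonneg fun _ _ =>
    overlapSum_nonneg _ _ _
  have hlam0 : 0 ≤ lam := Finset.sum_nonneg fun k _ => by positivity
  have hd2 : |d| ≤ 2 := abs_poissonMean_le (fun k => (abs_sub _ _).trans
    (by linarith [hb1 k, hb1 (k + 1)])) hlam0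
  have herr : errorTerm A m s w = q + R := rfl
  rw [herr]
  by_cases hgood : m / 2 ≤ l ∧ ∀ k ∈ A, |u k - s ^ k| ≤ 1
  · obtain ⟨hl2, hu1⟩ := hgood
    set τ := rateFun A u l with hτ
    have hl0 : 0 ≤ l := by linarith
    have hτ0 : 0 ≤ τ := Finset.sum_nonneg fun k _ => by
      have : 0 ≤ u k := mul_nonneg (by positivity) (Finset.sum_nonneg fun α _ =>
        Finset.prod_nonneg fun i _ => sq_nonneg _)
      positivity
    have h1 : |H - poissonMean b τ| ≤ C₂ * R :=
      abs_graphMean_sub_poissonMean_rateFun_le hw hn hA hm hl2 (rateFun_le hm hs hl2 hu1) B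
    have h2 := abs_poissonMean_taylor_le hb1 hlam0 hτ0
    rw [← hd] at h2
    obtain ⟨h3, h4⟩ := hexp u l hl2
    have h5 : |d * (τ - lam - lin)| ≤ 2 * (C₁ * q) := by
      rw [abs_mul]
      exact mul_le_mul hd2 h3 (abs_nonneg _) zero_le_two
    have heq : H - poissonMean b lam - d * lin = (H - poissonMean b τ) +
        (poissonMean b τ - poissonMean b lam - d * (τ - lam)) + d * (τ - lam - lin) := by ring
    rw [heq]
    calc _ ≤ C₂ * R + 4 * 1 * (τ - lam) ^ 2 + 2 * (C₁ * q) :=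
          (abs_add_le _ _).trans (add_le_add ((abs_add_le _ _).trans (add_le_add h1 h2)) h5)
      _ ≤ C₂ * R + 6 * C₁ * q := by linarith
      _ ≤ (C₂ + 6 * C₁) * (q + R) := by
          have := mul_nonneg hC₁ hR0
          have := mul_nonneg hC₂0 hq0
          linarith
      _ ≤ _ := mul_le_mul_of_nonneg_right (by linarith) (by linarith)
  · -- The exceptional weights deviate from the limits by at least a constant.
    have hbad : 1 ≤ C₃ * q := by
      rw [not_and_or] at hgood
      rcases hgood with h | h
      · have h1 : m ^ 2 / 4 ≤ q := by
          have h2 : (m / 2) ^ 2 ≤ (l - m) ^ 2 := by nlinarith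
          have h3 : (l - m) ^ 2 ≤ q :=
            le_add_of_nonneg_right (Finset.sum_nonneg fun _ _ => sq_nonneg _)
          linarith
        calc (1 : ℝ) = 4 / m ^ 2 * (m ^ 2 / 4) := by field_simp
          _ ≤ C₃ * q := mul_le_mul (by linarith) h1 (by positivity) hC₃0
      · push Not at h
        obtain ⟨k, hk, hk1⟩ := h
        have h1 : 1 ≤ q := by
          have h2 := sq_add_sq_le_sqDev hk m s u l
          have h3 : 1 ≤ (u k - s ^ k) ^ 2 := by
            rw [← sq_abs]
            nlinarith
          linarith [sq_nonneg (l - m)]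
        calc (1 : ℝ) = 1 * 1 := by ring
          _ ≤ C₃ * q := mul_le_mul (by
            have : 0 ≤ 4 / m ^ 2 := by positivity
            linarith) h1 zero_le_one hC₃0
    have hH' := graphMean_indicator_mem_Icc hw B (cycleCount A)
    have hp' := poissonMean_indicator_mem_Icc B hlam0
    have h1 : |H - poissonMean b lam| ≤ 1 := by
      rw [abs_le]
      constructor <;> linarith [hH'.1, hH'.2, hp'.1, hp'.2]
    have h2 : |d * lin| ≤ 1 + C₁ * q := by
      rw [abs_mul]
      have h3 := hlin u l
      have h4 : |d| * |lin| ≤ 2 * |lin| := mul_le_mul_of_nonneg_right hd2 (abs_nonneg _)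
      have h5 : 2 * |lin| ≤ 1 + lin ^ 2 := by
        rw [← sq_abs lin]
        nlinarith [sq_nonneg (|lin| - 1)]
      linarith
    calc _ ≤ 1 + (1 + C₁ * q) := (abs_sub _ _).trans (add_le_add h1 h2)
      _ ≤ (2 * C₃ + C₁) * q := by linarith
      _ ≤ _ := mul_le_mul (by
          have : 0 ≤ 6 * C₁ := by positivity
          linarith) (by linarith) hq0 (by positivity)

/-! ### Expectation over the weights -/

theorem injMean_one (w : Fin n → ℝ) :
    injMean (fun x => x) 1 w = meanWeight w := by
  classical
  have h : (Finset.univ.filter fun α : Fin 1 → Fin n => Function.Injective α) = Finset.univ :=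
    Finset.filter_true_of_mem fun α _ => Function.injective_of_subsingleton α
  rw [injMean, h, meanWeight, pow_one, div_eq_mul_inv, mul_comm]
  congr 1
  exact Fintype.sum_equiv (Equiv.funUnique (Fin 1) (Fin n)) _ _ fun α => by simp

theorem le_one_add_sq {x : ℝ} (hx : 0 < x) : x ≤ (1 + x) ^ 2 := by nlinarith

theorem sq_le_one_add_sq {x : ℝ} (hx : 0 < x) : x ^ 2 ≤ (1 + x) ^ 2 := by nlinarith

theorem exists_integral_errorTerm_le (hpos : ∀ᵐ x ∂ν, 0 < x)
    (h4 : Integrable (fun x => x ^ 4) ν) (A : Finset ℕ) :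
    ∃ C : ℝ, 0 ≤ C ∧ ∀ n : ℕ, 1 ≤ n →
      Integrable (fun w : Fin n → ℝ => errorTerm A (∫ x, x ∂ν) (∫ x, x ^ 2 ∂ν) w)
        (Measure.pi fun _ => ν) ∧
      ∫ w : Fin n → ℝ, errorTerm A (∫ x, x ∂ν) (∫ x, x ^ 2 ∂ν) w ∂(Measure.pi fun _ => ν) ≤
        C / n := by
  obtain ⟨C₁, hC₁, h1⟩ := exists_integral_injMean_sub_sq_le hpos h4 (g := fun x => x)
    measurable_id (fun x hx => hx.le) (fun x hx => le_one_add_sq hx) 1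
  choose C₂ hC₂ h2 using fun k => exists_integral_injMean_sub_sq_le hpos h4 (g := fun x => x ^ 2)
    (by fun_prop) (fun x _ => sq_nonneg x) (fun x hx => sq_le_one_add_sq hx) k
  set D : ℕ → ℕ → ℝ := fun k k' =>
    (∫ x, (1 + x) ^ 4 ∂ν) ^ (k + k') * (((k : ℝ) + k') ^ k' * (k : ℝ) ^ k) with hD
  have hM := one_le_integral_one_add_pow hpos h4
  have hD0 : ∀ k k', 0 ≤ D k k' := fun k k' => by positivity
  refine ⟨C₁ + ∑ k ∈ A, C₂ k + ∑ k ∈ A, ∑ k' ∈ A, D k k', ?_, fun n hn => ?_⟩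
  · exact add_nonneg (add_nonneg hC₁ (Finset.sum_nonneg fun k _ => hC₂ k))
      (Finset.sum_nonneg fun _ _ => Finset.sum_nonneg fun _ _ => hD0 _ _)
  obtain ⟨hi1, hb1⟩ := h1 n hn
  simp only [injMean_one, pow_one] at hi1 hb1
  have hi2 : Integrable (fun w : Fin n → ℝ => ∑ k ∈ A, (sqMeans w k - (∫ x, x ^ 2 ∂ν) ^ k) ^ 2)
      (Measure.pi fun _ => ν) := integrable_finsetSum _ fun k _ => (h2 k n hn).1
  have hi3 : Integrable (fun w : Fin n → ℝ => ∑ k ∈ A, ∑ k' ∈ A, overlapSum k k' w)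
      (Measure.pi fun _ => ν) :=
    integrable_finsetSum _ fun k _ => integrable_finsetSum _ fun k' _ =>
      integrable_overlapSum hpos h4 k k'
  refine ⟨(hi1.add hi2).add hi3, ?_⟩
  have heq : ∫ w : Fin n → ℝ, errorTerm A (∫ x, x ∂ν) (∫ x, x ^ 2 ∂ν) w
      ∂(Measure.pi fun _ => ν) =
      ∫ w : Fin n → ℝ, (meanWeight w - ∫ x, x ∂ν) ^ 2 ∂(Measure.pi fun _ => ν) +
      ∑ k ∈ A, ∫ w : Fin n → ℝ, (sqMeans w k - (∫ x, x ^ 2 ∂ν) ^ k) ^ 2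
        ∂(Measure.pi fun _ => ν) +
      ∑ k ∈ A, ∑ k' ∈ A, ∫ w : Fin n → ℝ, overlapSum k k' w ∂(Measure.pi fun _ => ν) := by
    have hi12 : Integrable (fun w : Fin n → ℝ => (meanWeight w - ∫ x, x ∂ν) ^ 2 +
        ∑ k ∈ A, (sqMeans w k - (∫ x, x ^ 2 ∂ν) ^ k) ^ 2) (Measure.pi fun _ => ν) := hi1.add hi2
    simp only [errorTerm, sqDev]
    have hi2' : ∀ k, Integrable (fun w : Fin n → ℝ => (sqMeans w k - (∫ x, x ^ 2 ∂ν) ^ k) ^ 2)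
      (Measure.pi fun _ => ν) := fun k => (h2 k n hn).1
    rw [integral_add hi12 hi3, integral_add hi1 hi2, integral_finsetSum _ fun k _ => hi2' k,
      integral_finsetSum _ fun k _ => integrable_finsetSum _ fun k' _ =>
        integrable_overlapSum hpos h4 k k']
    congr 1
    exact Finset.sum_congr rfl fun k _ => integral_finsetSum _ fun k' _ =>
      integrable_overlapSum hpos h4 k k'
  rw [heq, add_div, add_div, Finset.sum_div, Finset.sum_div]
  refine add_le_add (add_le_add hb1 (Finset.sum_le_sum fun k _ => (h2 k n hn).2))
    (Finset.sum_le_sum fun k _ => ?_)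
  rw [Finset.sum_div]
  exact Finset.sum_le_sum fun k' _ => integral_overlapSum_le hpos h4 hn k k'

/-- The linear term fluctuates at order `1 / √n`, but its expectation is `O(1 / n)`: the mean weight
is centred, and the sums over injective tuples are centred up to the few tuples left out. -/
theorem exists_abs_integral_rateLin_le (hpos : ∀ᵐ x ∂ν, 0 < x)
    (h4 : Integrable (fun x => x ^ 4) ν) (A : Finset ℕ) :
    ∃ C : ℝ, 0 ≤ C ∧ ∀ n : ℕ, 1 ≤ n →
      Integrable (fun w : Fin n → ℝ =>
        rateLin A (∫ x, x ∂ν) (∫ x, x ^ 2 ∂ν) (sqMeans w) (meanWeight w))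
        (Measure.pi fun _ => ν) ∧
      |∫ w : Fin n → ℝ, rateLin A (∫ x, x ∂ν) (∫ x, x ^ 2 ∂ν) (sqMeans w) (meanWeight w)
        ∂(Measure.pi fun _ => ν)| ≤ C / n := by
  set m := ∫ x, x ∂ν with hm
  set s := ∫ x, x ^ 2 ∂ν with hs
  set D : ℕ → ℝ := fun k => 1 / (2 * (k : ℝ)) * (|m⁻¹ ^ k| * (|s| ^ k * (k : ℝ) ^ k) +
    |s ^ k * (k * m⁻¹ ^ (k + 1))| * (|m| ^ 1 * ((1 : ℕ) : ℝ) ^ 1)) with hD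
  refine ⟨∑ k ∈ A, D k, Finset.sum_nonneg fun k _ => by positivity, fun n hn => ?_⟩
  have hi1 : Integrable (fun w : Fin n → ℝ => meanWeight w - m) (Measure.pi fun _ => ν) := by
    have := integrable_injMean (n := n) hpos h4 (g := fun x => x)
      measurable_id (fun x hx => hx.le) (fun x hx => le_one_add_sq hx) 1
    simp only [funext injMean_one] at this
    exact this.sub (integrable_const _)
  have hb1 : |∫ w : Fin n → ℝ, (meanWeight w - m) ∂(Measure.pi fun _ => ν)| ≤
      |m| ^ 1 * ((1 : ℕ) : ℝ) ^ 1 / n := by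
    have hi := integrable_injMean (n := n) hpos h4 (g := fun x => x)
      measurable_id (fun x hx => hx.le) (fun x hx => le_one_add_sq hx) 1
    have := abs_integral_injMean_sub_le hpos h4 (g := fun x => x)
      measurable_id (fun x hx => hx.le) (fun x hx => le_one_add_sq hx) hn 1
    simp only [injMean_one] at this
    simp only [funext injMean_one] at hi
    rw [integral_sub hi (integrable_const _)]
    simpa using this
  have hi2' : ∀ k, Integrable (fun w : Fin n → ℝ => sqMeans w k) (Measure.pi fun _ => ν) :=
    fun k => integrable_injMean hpos h4 (by fun_prop) (fun x _ => sq_nonneg x)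
      (fun x hx => sq_le_one_add_sq hx) k
  have hi2 : ∀ k, Integrable (fun w : Fin n → ℝ => sqMeans w k - s ^ k)
      (Measure.pi fun _ => ν) := fun k => (hi2' k).sub (integrable_const _)
  have hb2 : ∀ k, |∫ w : Fin n → ℝ, (sqMeans w k - s ^ k) ∂(Measure.pi fun _ => ν)| ≤
      |s| ^ k * (k : ℝ) ^ k / n := fun k => by
    have := abs_integral_injMean_sub_le hpos h4 (g := fun x => x ^ 2)
      (by fun_prop) (fun x _ => sq_nonneg x) (fun x hx => sq_le_one_add_sq hx) hn k
    rw [integral_sub (hi2' k) (integrable_const _), integral_const]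
    simp only [probReal_univ, smul_eq_mul, one_mul]
    exact this
  have hterm : ∀ k ∈ A, Integrable (fun w : Fin n → ℝ =>
      1 / (2 * (k : ℝ)) * mulInvPowLin m (s ^ k) k (sqMeans w k) (meanWeight w))
      (Measure.pi fun _ => ν) := fun k _ =>
    (((hi2 k).const_mul _).sub (hi1.const_mul _)).const_mul _
  refine ⟨integrable_finsetSum _ hterm, ?_⟩
  simp only [rateLin]
  rw [integral_finsetSum _ hterm, Finset.sum_div]
  refine (Finset.abs_sum_le_sum_abs _ _).trans (Finset.sum_le_sum fun k _ => ?_)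
  simp only [mulInvPowLin]
  rw [integral_const_mul, integral_sub ((hi2 k).const_mul _) (hi1.const_mul _),
    integral_const_mul, integral_const_mul, abs_mul,
    abs_of_nonneg (by positivity : 0 ≤ 1 / (2 * (k : ℝ))), hD, mul_div_assoc]
  refine mul_le_mul_of_nonneg_left ?_ (by positivity)
  refine (abs_sub _ _).trans ?_
  rw [abs_mul, abs_mul]
  refine (add_le_add (mul_le_mul_of_nonneg_left (hb2 k) (abs_nonneg _))
    (mul_le_mul_of_nonneg_left hb1 (abs_nonneg _))).trans_eq ?_
  ring

theorem measurable_graphMean (F : SimpleGraph (Fin n) → ℝ) :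
    Measurable fun w : Fin n → ℝ => graphMean w F :=
  Finset.measurable_fun_sum _ fun H _ => (measurable_graphProb H).mul_const _

theorem integrable_graphMean_indicator (hpos : ∀ᵐ x ∂ν, 0 < x) (B : Set ℕ)
    (S : SimpleGraph (Fin n) → ℕ) :
    Integrable (fun w : Fin n → ℝ => graphMean w fun G => B.indicator 1 (S G))
      (Measure.pi fun _ => ν) := by
  refine Integrable.mono' (integrable_const 1) (measurable_graphMean _).aestronglyMeasurable ?_
  filter_upwards [ae_pi_pos hpos] with w hw
  have h := graphMean_indicator_mem_Icc hw B S
  rw [Real.norm_of_nonneg h.1]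
  exact h.2

/-- The law of a statistic of the graph is obtained by averaging its conditional law over the
weights. -/
theorem graphLaw_map_real_eq (hpos : ∀ᵐ x ∂ν, 0 < x) {S : SimpleGraph (Fin n) → ℕ}
    (hS : Measurable S) (B : Set ℕ) :
    ((graphLaw ν n).map S).real B =
      ∫ w : Fin n → ℝ, graphMean w (fun G => B.indicator 1 (S G)) ∂(Measure.pi fun _ => ν) := by
  have hB : MeasurableSet B := MeasurableSet.of_discrete
  have hSB : MeasurableSet (S ⁻¹' B) := hS hB
  have hnn : 0 ≤ᵐ[Measure.pi fun _ : Fin n => ν]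
      fun w => graphMean w (fun G => B.indicator 1 (S G)) := by
    filter_upwards [ae_pi_pos hpos] with w hw
    exact (graphMean_indicator_mem_Icc hw B S).1
  rw [measureReal_def, Measure.map_apply hS hB, graphLaw,
    Measure.bind_apply hSB (graphKernel n).measurable.aemeasurable,
    integral_eq_lintegral_of_nonneg_ae hnn (measurable_graphMean _).aestronglyMeasurable]
  congr 1
  refine lintegral_congr_ae ?_
  filter_upwards [ae_pi_pos hpos] with w hw
  have hk : graphKernel n w = Measure.sum fun H : SimpleGraph (Fin n) =>
    ENNReal.ofReal (graphProb w H) • Measure.dirac H := rfl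
  rw [hk, Measure.sum_apply _ hSB, tsum_fintype, graphMean,
    ENNReal.ofReal_sum_of_nonneg fun H _ => mul_nonneg (graphProb_nonneg hw H)
      (Set.indicator_nonneg (by simp) _)]
  refine Finset.sum_congr rfl fun H _ => ?_
  rw [Measure.smul_apply, Measure.dirac_apply' _ hSB, smul_eq_mul,
    ENNReal.ofReal_mul (graphProb_nonneg hw H)]
  congr 1
  by_cases h : S H ∈ B <;> simp [h]

theorem exists_tvDist_cycleCount_le (hpos : ∀ᵐ x ∂ν, 0 < x)
    (h4 : Integrable (fun x => x ^ 4) ν) {N : ℕ} {A : Finset ℕ} (hA : A ⊆ Finset.Icc 3 N) :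
    ∃ C : ℝ, 0 ≤ C ∧ ∀ n : ℕ, 1 ≤ n → ∀ r : ℝ≥0,
      (r : ℝ) = rateFun A (fun k => (∫ x, x ^ 2 ∂ν) ^ k) (∫ x, x ∂ν) →
      tvDist ((graphLaw ν n).map (cycleCount A)) (poissonMeasure r) ≤ C / n := by
  have hint : Integrable (fun x => x) ν := integrable_of_le_sq hpos h4
    measurable_id (fun x hx => hx.le) (fun x hx => le_one_add_sq hx)
  have hm : 0 < ∫ x, x ∂ν := by
    rw [integral_pos_iff_support_of_nonneg_ae (hpos.mono fun x hx => hx.le) hint]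
    have hsupp : Function.support (fun x : ℝ => x) =ᵐ[ν] Set.univ := by
      filter_upwards [hpos] with x hx
      exact propext ⟨fun _ => trivial, fun _ => hx.ne'⟩
    rw [measure_congr hsupp, measure_univ]
    exact one_pos
  have hs : 0 ≤ ∫ x, x ^ 2 ∂ν := integral_nonneg fun x => sq_nonneg x
  obtain ⟨C₁, hC₁, h1⟩ := exists_abs_graphMean_taylor_le hm hs hA
  obtain ⟨C₂, hC₂, h2⟩ := exists_integral_errorTerm_le hpos h4 A
  obtain ⟨C₃, hC₃, h3⟩ := exists_abs_integral_rateLin_le hpos h4 A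
  refine ⟨C₁ * C₂ + 2 * C₃, by positivity, fun n hn r hr => ciSup_le fun B => ?_⟩
  obtain ⟨hi2, hb2⟩ := h2 n hn
  obtain ⟨hi3, hb3⟩ := h3 n hn
  set m := ∫ x, x ∂ν with hm_def
  set s := ∫ x, x ^ 2 ∂ν with hs_def
  rw [graphLaw_map_real_eq hpos (measurable_cycleCount A), poissonMeasure_real_eq_poissonMean, hr]
  set lam := rateFun A (fun k => s ^ k) m with hlam
  have hlam0 : 0 ≤ lam := hr ▸ r.2
  set d := poissonMean (fun k => B.indicator 1 (k + 1) - B.indicator 1 k) lam with hd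
  have hd2 : |d| ≤ 2 := abs_poissonMean_le (fun k => (abs_sub _ _).trans
    (by linarith [abs_indicator_one_le B k, abs_indicator_one_le B (k + 1)])) hlam0
  have hi1 := integrable_graphMean_indicator (n := n) hpos B (cycleCount A)
  have hi1' : Integrable (fun w : Fin n → ℝ =>
    graphMean w (fun G => B.indicator 1 (cycleCount A G)) - poissonMean (B.indicator 1) lam)
    (Measure.pi fun _ => ν) := hi1.sub (integrable_const _)
  have heq : ∫ w : Fin n → ℝ, graphMean w (fun G => B.indicator 1 (cycleCount A G))
        ∂(Measure.pi fun _ => ν) - poissonMean (B.indicator 1) lam =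
      ∫ w : Fin n → ℝ, (graphMean w (fun G => B.indicator 1 (cycleCount A G)) -
        poissonMean (B.indicator 1) lam - d * rateLin A m s (sqMeans w) (meanWeight w))
        ∂(Measure.pi fun _ => ν) +
      d * ∫ w : Fin n → ℝ, rateLin A m s (sqMeans w) (meanWeight w) ∂(Measure.pi fun _ => ν) := by
    rw [integral_sub hi1' (hi3.const_mul d), integral_sub hi1 (integrable_const _),
      integral_const_mul, integral_const]
    simp
  rw [heq]
  have hb1 : |∫ w : Fin n → ℝ, (graphMean w (fun G => B.indicator 1 (cycleCount A G)) -
        poissonMean (B.indicator 1) lam - d * rateLin A m s (sqMeans w) (meanWeight w))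
        ∂(Measure.pi fun _ => ν)| ≤ C₁ * (C₂ / n) := by
    rw [← Real.norm_eq_abs]
    refine (norm_integral_le_of_norm_le (hi2.const_mul C₁) ?_).trans ?_
    · filter_upwards [ae_pi_pos hpos] with w hw
      exact h1 n w hn hw B
    · rw [integral_const_mul]
      exact mul_le_mul_of_nonneg_left hb2 hC₁
  calc _ ≤ C₁ * (C₂ / n) + 2 * (C₃ / n) := by
        refine (abs_add_le _ _).trans (add_le_add hb1 ?_)
        rw [abs_mul]
        exact mul_le_mul hd2 hb3 (abs_nonneg _) zero_le_two
    _ = _ := by ring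

end GenRandGraph

theorem theorem2p2 {Ω : Type*} [MeasurableSpace Ω] (μ : Measure Ω) [IsProbabilityMeasure μ]
    (W : Ω → ℝ) (hW : AEMeasurable W μ) (hpos : ∀ᵐ ω ∂μ, 0 < W ω)
    (hW4 : Integrable (fun ω => W ω ^ 4) μ) (N : ℕ) :
    ∃ C : ℝ, 0 < C ∧ ∀ A : Finset ℕ, A ⊆ Finset.Icc 3 N → ∀ n : ℕ, 3 ≤ n →
      GenRandGraph.tvDist
          ((GenRandGraph.graphLaw (μ.map W) n).map (GenRandGraph.cycleCount A))
          (poissonMeasure (∑ k ∈ A, GenRandGraph.cycleRate μ W k).toNNReal)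
        ≤ C / n := by
  have : IsProbabilityMeasure (μ.map W) := Measure.isProbabilityMeasure_map hW
  have hpos' : ∀ᵐ x ∂(μ.map W), 0 < x := (ae_map_iff hW measurableSet_Ioi).2 hpos
  have h4 : Integrable (fun x => x ^ 4) (μ.map W) :=
    (integrable_map_measure (by fun_prop) hW).2 hW4
  have hm : ∫ x, x ∂(μ.map W) = ∫ ω, W ω ∂μ := integral_map hW (by fun_prop)
  have hs : ∫ x, x ^ 2 ∂(μ.map W) = ∫ ω, W ω ^ 2 ∂μ := integral_map hW (by fun_prop)
  have hm0 : 0 ≤ ∫ ω, W ω ∂μ := integral_nonneg_of_ae (hpos.mono fun ω hω => hω.le)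
  have hs0 : 0 ≤ ∫ ω, W ω ^ 2 ∂μ := integral_nonneg fun ω => sq_nonneg _
  have hrate : ∀ A : Finset ℕ, ((∑ k ∈ A, GenRandGraph.cycleRate μ W k).toNNReal : ℝ) =
      GenRandGraph.rateFun A (fun k => (∫ x, x ^ 2 ∂(μ.map W)) ^ k) (∫ x, x ∂(μ.map W)) := by
    intro A
    rw [Real.coe_toNNReal _ (Finset.sum_nonneg fun k _ => by
      rw [GenRandGraph.cycleRate]
      positivity), GenRandGraph.rateFun, hm, hs]
    refine Finset.sum_congr rfl fun k _ => ?_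
    rw [GenRandGraph.cycleRate, div_pow, inv_pow, div_eq_mul_inv (_ ^ k)]
  choose! C hC0 hC using fun (A : Finset ℕ) (hA : A ⊆ Finset.Icc 3 N) =>
    GenRandGraph.exists_tvDist_cycleCount_le hpos' h4 hA
  have hC0' : ∀ A ∈ (Finset.Icc 3 N).powerset, 0 ≤ C A := fun A hA =>
    hC0 A (Finset.mem_powerset.1 hA)
  refine ⟨∑ A ∈ (Finset.Icc 3 N).powerset, C A + 1,
    add_pos_of_nonneg_of_pos (Finset.sum_nonneg hC0') one_pos, fun A hA n hn => ?_⟩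
  refine (hC A hA n (by omega) _ (hrate A)).trans ?_
  gcongr
  exact (Finset.single_le_sum hC0' (Finset.mem_powerset.2 hA)).trans (by linarith)
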